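/- Conventions. Let $\kappa$ be an inaccessible cardinal. $\mathbf{Gpd}^{\mathbb{Z}_2}$ is the category of groupoids with an involution and equivariant functors. In its injective model structure a morphism is an acyclic cofibration if its underlying functor is an equivalence of groupoids that is injective on objects, and it is a fibration if it has the right lifting property with respect to all of these; $(\mathbf{Gpd}^{\mathbb{Z}_2})_{\mathbf f}$ is the full subcategory of fibrant objects, with these fibrations. In the projective structure every object is fibrant, and the fibrations are the equivariant functors whose underlying functor lifts isomorphisms. In a category with a class of fibrations, call a morphism an acyclic cofibration if it has the left lifting property with respect to all fibrations. A path object of $f\colon A\to C$ is a factorization of the diagonal $A\to A\times_C A$ as an acyclic cofibration $A\to P$ followed by a fibration $P\to A\times_C A$; right homotopies between maps into $Y$ are maps into a path object of $Y\to 1$, and a right homotopy equivalence is a map with a two-sided inverse up to right homotopy. Given $p\colon V\to U$ and a path object of $p$, the object $E\to U\times U$ of equivalences is the interpretation of the type $\sum_{f\colon A\to B}\bigl(\sum_{g\colon B\to A}\prod_x \mathrm{Id}(gfx,x)\bigr)\times\bigl(\sum_{h\colon B\to A}\prod_y \mathrm{Id}(fhy,y)\bigr)$: it represents the functor sending $(a,b)\colon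 T\to U\times U$ to the set of such data between $a^*V$ and $b^*V$ over $T$, with identity types given by the path object. There is a map $U\to E$ classifying the identity equivalence of $p$, and $p$ is univalent if, for some path object of $p$, $E$ exists and $U\to E$ is a right homotopy equivalence. For $f\colon A\to C$ in $\mathbf{Gpd}^{\mathbb{Z}_2}$, $P_CA$ is the groupoid of isomorphisms $\varphi\colon x\to y$ of $A$ with $f(\varphi)$ an identity, whose morphisms are the commutative squares $(\rho,\tau)$ with $f(\rho)=f(\tau)$, with the componentwise involution; $\delta_1\colon A\to P_CA$ is $x\mapsto (x,x,1_x)$ and $\delta_2\colon P_CA\to A\times_CA$ is $(x,y,\varphi)\mapsto(x,y)$. Let $U$ be the groupoid of triples $(A,B,\varphi)$, where $A,B$ are $\kappa$-small discrete groupoids and $\varphi\colon A\cong B$; its morphisms $(A,B,\varphi)\to(C,D,\psi)$ are the pairs of isomorphisms $(\rho\colon A\to C,\tau\colon B\to D)$ with $\psi\rho=\tau\varphi$, and its involution is $(A,B,\varphi)\mapsto(B,A,\varphi^{-1})$, $(\rho,\tau)\mapsto(\tau,\rho)$. Let $\widetilde U$ be the groupoid of tuples $(A,B,\varphi,a)$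 with moreover $a\in A$, morphisms being required to preserve $a$, with the involution $(A,B,\varphi,a)\mapsto(B,A,\varphi^{-1},\varphi(a))$, $(\rho,\tau)\mapsto(\tau,\rho)$, and let $p\colon\widetilde U\to U$ be the projection. Theorem. (1) In the injective structure, $1$, $U$, $\widetilde U$, $P_U\widetilde U$ and $P_1U$ are fibrant, $p$ is a fibration, and $p$ is univalent in $(\mathbf{Gpd}^{\mathbb{Z}_2})_{\mathbf f}$. Moreover $\delta_1\colon U\to P_1U$ is an acyclic cofibration of the injective model structure, $(P_1U,\delta_1,\delta_2)$ is a path object of $U\to 1$, and $\delta_1$ is a right homotopy equivalence; $(P_U\widetilde U,\delta_1,\delta_2)$ is a path object of $p$, the object $E$ of equivalences formed with it exists, and there is an isomorphism $E\cong P_1U$ over $U\times U$ that carries $U\to E$ to $\delta_1\colon U\to P_1U$. In particular $U\to E$ is an acyclic cofibration and a right homotopy equivalence. (2) In the projective structure on $\mathbf{Gpd}^{\mathbb{Z}_2}$ all objects are fibrant, $p$ is a fibration, $(P_U\widetilde U,\delta_1,\delta_2)$ is a path object of $p$, and the object of equivalences formed with it exists, but $p$ is not univalent. -/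

import Mathlib

open CategoryTheory CategoryTheory.Limits

universe v u w

namespace TTFib

/-! ### Path objects, right homotopies and univalence in a category with a class of fibrations -/

section General

variable {C : Type u} [Category.{v} C]

/-- `(P, r, d₀, d₁)` is a (very good) path object of `f : A ⟶ B`: the diagonal
`A ⟶ A ×_B A` is factored as `r : A ⟶ P`, which has the left lifting property with respect to all
fibrations (an acyclic cofibration), followed by a fibration `(d₀, d₁) : P ⟶ A ×_B A`. -/
structure IsPathObject (Fib : MorphismProperty C) {A B P : C} (f : A ⟶ B)
    (r : A ⟶ P) (d₀ d₁ : P ⟶ A) : Prop where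
  r_d₀ : r ≫ d₀ = 𝟙 A
  r_d₁ : r ≫ d₁ = 𝟙 A
  comm : d₀ ≫ f = d₁ ≫ f
  acyclicCofibration : Fib.llp r
  fibration : ∃ (W : C) (fst snd : W ⟶ A) (h : IsPullback fst snd f f),
    Fib (h.lift d₀ d₁ comm)

/-- `f` and `g` are right homotopic: they are the two ends of a map into a path object of `Y`
(a path object of the map from `Y` to a terminal object). -/
def RightHomotopic (Fib : MorphismProperty C) {X Y : C} (f g : X ⟶ Y) : Prop :=
  ∃ (T : C) (hT : IsTerminal T) (P : C) (r : Y ⟶ P) (d₀ d₁ : P ⟶ Y) (H : X ⟶ P),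
    IsPathObject Fib (hT.from Y) r d₀ d₁ ∧ H ≫ d₀ = f ∧ H ≫ d₁ = g

def IsRightHomotopyEquiv (Fib : MorphismProperty C) {X Y : C} (f : X ⟶ Y) : Prop :=
  ∃ g : Y ⟶ X, RightHomotopic Fib (f ≫ g) (𝟙 X) ∧ RightHomotopic Fib (g ≫ f) (𝟙 Y)

/-- A pullback of `p` along `a`: the dependent type over `T` named by `a`. -/
structure PullbackOf {V U T : C} (p : V ⟶ U) (a : T ⟶ U) where
  X : C
  top : X ⟶ V
  left : X ⟶ T
  isPullback : IsPullback top left p a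

/-- The pullback of `p` along the identity. -/
def PullbackOf.self {V U : C} (p : V ⟶ U) : PullbackOf p (𝟙 U) where
  X := V
  top := 𝟙 V
  left := p
  isPullback := IsPullback.of_horiz_isIso ⟨by simp⟩

/-- A (bi-invertible) equivalence over `T` between the two pullbacks `S₁`, `S₂` of `p`, i.e. a term
in context `T` of the type
`Σ (f : S₁ → S₂), (Σ (g : S₂ → S₁), Π x, Id (g (f x)) x) × (Σ (h : S₂ → S₁), Π y, Id (f (h y)) y)`,
where identity types are interpreted by the path object `(P, d₀, d₁)` of `p`. -/
structure EquivOver {V U P : C} (p : V ⟶ U) (d₀ d₁ : P ⟶ V) {T : C} {a b : T ⟶ U}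
    (S₁ : PullbackOf p a) (S₂ : PullbackOf p b) where
  f : S₁.X ⟶ S₂.X
  f_left : f ≫ S₂.left = S₁.left
  /-- the left homotopy inverse -/
  g : S₂.X ⟶ S₁.X
  g_left : g ≫ S₁.left = S₂.left
  /-- the fibrewise homotopy from `g ∘ f` to the identity -/
  H : S₁.X ⟶ P
  H_d₀ : H ≫ d₀ = f ≫ g ≫ S₁.top
  H_d₁ : H ≫ d₁ = S₁.top
  /-- the right homotopy inverse -/
  h : S₂.X ⟶ S₁.X
  h_left : h ≫ S₁.left = S₂.left
  /-- the fibrewise homotopy from `f ∘ h` to the identity -/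
  K : S₂.X ⟶ P
  K_d₀ : K ≫ d₀ = h ≫ f ≫ S₂.top
  K_d₁ : K ≫ d₁ = S₂.top

/-- The identity equivalence of `p`, with constant homotopies. -/
def EquivOver.refl {V U P : C} (p : V ⟶ U) (r : V ⟶ P) (d₀ d₁ : P ⟶ V)
    (h₀ : r ≫ d₀ = 𝟙 V) (h₁ : r ≫ d₁ = 𝟙 V) :
    EquivOver p d₀ d₁ (PullbackOf.self p) (PullbackOf.self p) where
  f := 𝟙 V
  f_left := Category.id_comp _
  g := 𝟙 V
  g_left := Category.id_comp _
  H := r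
  H_d₀ := by simp [PullbackOf.self, h₀]
  H_d₁ := h₁
  h := 𝟙 V
  h_left := Category.id_comp _
  K := r
  K_d₀ := by simp [PullbackOf.self, h₀]
  K_d₁ := h₁

/-- `e'` (over `T'`) is the substitution of `e` (over `T`) along `t : T' ⟶ T`; here `c₁`, `c₂` are
the comparison maps of the pullbacks (they are uniquely determined). -/
def EquivOver.IsRestriction {V U P : C} {p : V ⟶ U} {d₀ d₁ : P ⟶ V} {T T' : C}
    {a b : T ⟶ U} {a' b' : T' ⟶ U}
    {S₁ : PullbackOf p a} {S₂ : PullbackOf p b} {S₁' : PullbackOf p a'} {S₂' : PullbackOf p b'}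
    (e : EquivOver p d₀ d₁ S₁ S₂) (t : T' ⟶ T) (e' : EquivOver p d₀ d₁ S₁' S₂') : Prop :=
  t ≫ a = a' ∧ t ≫ b = b' ∧
  ∃ (c₁ : S₁'.X ⟶ S₁.X) (c₂ : S₂'.X ⟶ S₂.X),
    c₁ ≫ S₁.top = S₁'.top ∧ c₁ ≫ S₁.left = S₁'.left ≫ t ∧
    c₂ ≫ S₂.top = S₂'.top ∧ c₂ ≫ S₂.left = S₂'.left ≫ t ∧
    e'.f ≫ c₂ = c₁ ≫ e.f ∧
    e'.g ≫ c₁ = c₂ ≫ e.g ∧ e'.H = c₁ ≫ e.H ∧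
    e'.h ≫ c₁ = c₂ ≫ e.h ∧ e'.K = c₂ ≫ e.K

/-- The object `E` of equivalences over `U × U`, with its two projections `e₀`, `e₁` to `U`. It
carries a generic equivalence between the pullbacks of `p` along `e₀` and `e₁`, of which every
equivalence between pullbacks of `p` over some `T` is a substitution along exactly one map
`T ⟶ E`. -/
structure EquivObject {V U P : C} (p : V ⟶ U) (d₀ d₁ : P ⟶ V) where
  E : C
  e₀ : E ⟶ U
  e₁ : E ⟶ U
  S₁ : PullbackOf p e₀
  S₂ : PullbackOf p e₁
  generic : EquivOver p d₀ d₁ S₁ S₂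
  existsUnique : ∀ {T : C} {a b : T ⟶ U} (S₁' : PullbackOf p a) (S₂' : PullbackOf p b)
    (e : EquivOver p d₀ d₁ S₁' S₂'), ∃! t : T ⟶ E, generic.IsRestriction t e

/-- The map `U ⟶ E` which sends a type to its identity equivalence. -/
noncomputable def EquivObject.idMap {V U P : C} {p : V ⟶ U} {d₀ d₁ : P ⟶ V}
    (𝓔 : EquivObject p d₀ d₁) (r : V ⟶ P) (h₀ : r ≫ d₀ = 𝟙 V) (h₁ : r ≫ d₁ = 𝟙 V) : U ⟶ 𝓔.E :=
  (𝓔.existsUnique _ _ (EquivOver.refl p r d₀ d₁ h₀ h₁)).choose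

/-- The univalence property of `p : V ⟶ U`: for some path object of `p` the object `E` of
equivalences over `U × U` exists, and the map `U ⟶ E` that sends a type to its identity equivalence
is a right homotopy equivalence. (In a type-theoretic fibration category path objects and `E` always
exist, and the property does not depend on which path object is taken.) -/
def IsUnivalent (Fib : MorphismProperty C) {V U : C} (p : V ⟶ U) : Prop :=
  ∃ (P : C) (r : V ⟶ P) (d₀ d₁ : P ⟶ V) (hP : IsPathObject Fib p r d₀ d₁)
    (𝓔 : EquivObject p d₀ d₁), IsRightHomotopyEquiv Fib (𝓔.idMap r hP.r_d₀ hP.r_d₁)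

end General

/-! ### Groupoids with an involution and equivariant functors -/

/-- An object of `Gpd^{ℤ₂}`: a (small) groupoid with an involution. -/
structure InvGpd : Type (u + 1) where
  carrier : Type u
  [groupoid : Groupoid.{u} carrier]
  inv : carrier ⥤ carrier
  inv_inv : inv ⋙ inv = 𝟭 carrier

attribute [instance] InvGpd.groupoid

namespace InvGpd

/-- An equivariant functor. -/
@[ext]
structure Hom (X Y : InvGpd.{u}) where
  functor : X.carrier ⥤ Y.carrier
  comm : X.inv ⋙ functor = functor ⋙ Y.inv

instance : Category InvGpd.{u} where
  Hom X Y := Hom X Y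
  id X := ⟨𝟭 _, rfl⟩
  comp {X Y Z} f g := ⟨f.functor ⋙ g.functor, by
    rw [← Functor.assoc, f.comm, Functor.assoc, g.comm, Functor.assoc]⟩

/-- The one-object discrete groupoid. -/
def one : InvGpd.{u} where
  carrier := Discrete PUnit.{u + 1}
  inv := 𝟭 _
  inv_inv := rfl

def toOne (X : InvGpd.{u}) : X ⟶ one.{u} where
  functor := (Functor.const _).obj ⟨PUnit.unit⟩
  comm := rfl

/-- The acyclic cofibrations of the injective model structure: the underlying functor is an
equivalence of groupoids and is injective on objects. -/
def injAcyclicCof : MorphismProperty InvGpd.{u} := fun _ _ f =>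
  f.functor.IsEquivalence ∧ Function.Injective f.functor.obj

/-- The fibrations of the injective model structure. -/
def injFib : MorphismProperty InvGpd.{u} := injAcyclicCof.rlp

/-- The fibrations of the projective model structure: the underlying functor lifts isomorphisms. -/
def projFib : MorphismProperty InvGpd.{u} := fun X _ f =>
  ∀ (x : X.carrier) {y} (g : f.functor.obj x ⟶ y),
    ∃ (x' : X.carrier) (γ : x ⟶ x') (h : f.functor.obj x' = y),
      f.functor.map γ = g ≫ eqToHom h.symm

def injFibrant : ObjectProperty InvGpd.{u} := fun X => injFib (toOne X)

/-- `(Gpd^{ℤ₂})_f`: the full subcategory of fibrant objects of the injective model structure. -/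
abbrev FibObj : Type (u + 1) := injFibrant.{u}.FullSubcategory

/-- The fibrations of `(Gpd^{ℤ₂})_f`. -/
def fib : MorphismProperty FibObj.{u} := injFib.inverseImage injFibrant.ι

/-- An equivariant functor between fibrant objects, as a morphism of `(Gpd^{ℤ₂})_f`. -/
abbrev fibHom {X Y : InvGpd.{u}} (hX : injFibrant X) (hY : injFibrant Y) (f : X ⟶ Y) :
    (⟨X, hX⟩ : FibObj.{u}) ⟶ ⟨Y, hY⟩ :=
  ObjectProperty.homMk f

/-! ### The groupoid of paths `P_C A` of an equivariant functor `f : A ⟶ C` -/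

section Path

variable {A C : InvGpd.{u}} (f : A ⟶ C)

/-- An isomorphism `φ : x ⟶ y` of `A` such that `f φ` is an identity. -/
structure PathPt where
  x : A.carrier
  y : A.carrier
  φ : x ⟶ y
  vertical : ∃ h : f.functor.obj x = f.functor.obj y, f.functor.map φ = eqToHom h

/-- A commutative square; as `f` sends `P.φ` and `Q.φ` to identities, it follows that
`f ρ = f τ`. -/
@[ext]
structure PathHom (P Q : PathPt f) where
  ρ : P.x ⟶ Q.x
  τ : P.y ⟶ Q.y
  comm : ρ ≫ Q.φ = P.φ ≫ τ

instance : Groupoid (PathPt f) where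
  Hom P Q := PathHom f P Q
  id P := ⟨𝟙 _, 𝟙 _, by simp⟩
  comp s t := ⟨s.ρ ≫ t.ρ, s.τ ≫ t.τ, by
    rw [Category.assoc, t.comm, ← Category.assoc, s.comm, Category.assoc]⟩
  id_comp _ := PathHom.ext (Category.id_comp _) (Category.id_comp _)
  comp_id _ := PathHom.ext (Category.comp_id _) (Category.comp_id _)
  assoc _ _ _ := PathHom.ext (Category.assoc _ _ _) (Category.assoc _ _ _)
  inv s := ⟨Groupoid.inv s.ρ, Groupoid.inv s.τ, by
    have h := s.comm
    simp only [Groupoid.inv_eq_inv, IsIso.inv_comp_eq]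
    rw [← Category.assoc, h, Category.assoc, IsIso.hom_inv_id, Category.comp_id]⟩
  inv_comp _ := PathHom.ext (Groupoid.inv_comp _) (Groupoid.inv_comp _)
  comp_inv _ := PathHom.ext (Groupoid.comp_inv _) (Groupoid.comp_inv _)

/-- Apply an endofunctor of `A` lying over an endofunctor of `C` to a path. -/
def pathMap (F : A.carrier ⥤ A.carrier)
    (hF : ∃ G : C.carrier ⥤ C.carrier, F ⋙ f.functor = f.functor ⋙ G) :
    PathPt f ⥤ PathPt f where
  obj P :=
    { x := F.obj P.x
      y := F.obj P.y
      φ := F.map P.φ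
      vertical := by
        obtain ⟨G, hG⟩ := hF
        obtain ⟨h, hφ⟩ := P.vertical
        have hx := Functor.congr_obj hG P.x
        have hy := Functor.congr_obj hG P.y
        have hm := Functor.congr_hom hG P.φ
        simp only [Functor.comp_obj, Functor.comp_map] at hx hy hm
        refine ⟨hx.trans ((congrArg G.obj h).trans hy.symm), ?_⟩
        rw [hm, hφ]
        simp [eqToHom_map] }
  map s := ⟨F.map s.ρ, F.map s.τ, by rw [← F.map_comp, s.comm, F.map_comp]⟩
  map_id _ := PathHom.ext (F.map_id _) (F.map_id _)
  map_comp _ _ := PathHom.ext (F.map_comp _ _) (F.map_comp _ _)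

theorem pathMap_id (F : A.carrier ⥤ A.carrier) (h : F = 𝟭 _)
    (hF : ∃ G : C.carrier ⥤ C.carrier, F ⋙ f.functor = f.functor ⋙ G) :
    pathMap f F hF = 𝟭 _ := by
  subst h
  rfl

/-- `P_C A` with its involution, which applies the involution of `A` componentwise. -/
def path : InvGpd.{u} where
  carrier := PathPt f
  inv := pathMap f A.inv ⟨C.inv, f.comm⟩
  inv_inv :=
    pathMap_id f (A.inv ⋙ A.inv) A.inv_inv
      ⟨𝟭 _, by rw [A.inv_inv]; rfl⟩

theorem pathHom_heq {P P' Q Q' : PathPt f} (s : P ⟶ Q) (s' : P' ⟶ Q') (hP : P = P') (hQ : Q = Q')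
    (hρ : HEq (PathHom.ρ s) (PathHom.ρ s')) (hτ : HEq (PathHom.τ s) (PathHom.τ s')) :
    HEq s s' := by
  subst hP hQ
  exact heq_of_eq (PathHom.ext (eq_of_heq hρ) (eq_of_heq hτ))

/-- The underlying functor of `δ₁`. -/
def δ₁Functor : A.carrier ⥤ PathPt f where
  obj x := ⟨x, x, 𝟙 x, rfl, by simp⟩
  map g := ⟨g, g, by simp⟩
  map_id _ := rfl
  map_comp _ _ := rfl

theorem δ₁Functor_obj_inv (x : A.carrier) :
    (δ₁Functor f).obj (A.inv.obj x) = (path f).inv.obj ((δ₁Functor f).obj x) := by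
  change PathPt.mk _ _ (𝟙 (A.inv.obj x)) _ = PathPt.mk _ _ (A.inv.map (𝟙 x)) _
  congr 1
  exact (A.inv.map_id x).symm

/-- `δ₁ : A ⟶ P_C A`, `x ↦ (x, x, 1)`, `φ ↦ (φ, φ)`. -/
def δ₁ : A ⟶ path f where
  functor := δ₁Functor f
  comm := Functor.hext (δ₁Functor_obj_inv f) fun x y _ =>
    pathHom_heq f _ _ (δ₁Functor_obj_inv f x) (δ₁Functor_obj_inv f y) HEq.rfl HEq.rfl

/-- The first component of `δ₂ : P_C A ⟶ A ×_C A`. -/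
def src : path f ⟶ A where
  functor :=
    { obj := PathPt.x
      map := PathHom.ρ
      map_id := fun _ => rfl
      map_comp := fun _ _ => rfl }
  comm := rfl

/-- The second component of `δ₂ : P_C A ⟶ A ×_C A`. -/
def tgt : path f ⟶ A where
  functor :=
    { obj := PathPt.y
      map := PathHom.τ
      map_id := fun _ => rfl
      map_comp := fun _ _ => rfl }
  comm := rfl

end Path

/-! ### The universe of `κ`-small discrete groupoids paired with an isomorphism -/

section Universe

variable (κ : Cardinal.{w})

/-- Two `κ`-small discrete groupoids (i.e. sets) with an isomorphism between them. -/
structure UPt : Type (w + 1) where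
  A : Type w
  B : Type w
  hA : Cardinal.mk A < κ
  hB : Cardinal.mk B < κ
  φ : A ≃ B

/-- A point `(A, B, φ)` together with an element of `A`. -/
structure VPt : Type (w + 1) extends UPt.{w} κ where
  a : A

variable {κ}

@[ext]
structure UHom (X Y : UPt.{w} κ) : Type (w + 1) where
  ρ : X.A ≃ Y.A
  τ : X.B ≃ Y.B
  comm : ∀ x, Y.φ (ρ x) = τ (X.φ x)

@[ext]
structure VHom (X Y : VPt.{w} κ) : Type (w + 1) extends UHom X.toUPt Y.toUPt where
  map_a : ρ X.a = Y.a

def UHom.id (X : UPt.{w} κ) : UHom X X := ⟨Equiv.refl _, Equiv.refl _, fun _ => rfl⟩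

def UHom.comp {X Y Z : UPt.{w} κ} (s : UHom X Y) (t : UHom Y Z) : UHom X Z :=
  ⟨s.ρ.trans t.ρ, s.τ.trans t.τ, fun x => by simp [t.comm, s.comm]⟩

def UHom.inv {X Y : UPt.{w} κ} (s : UHom X Y) : UHom Y X :=
  ⟨s.ρ.symm, s.τ.symm, fun x => by
    rw [Equiv.eq_symm_apply, ← s.comm, Equiv.apply_symm_apply]⟩

instance : Groupoid (UPt.{w} κ) where
  Hom X Y := UHom X Y
  id X := UHom.id X
  comp s t := UHom.comp s t
  inv s := UHom.inv s
  inv_comp s := UHom.ext (Equiv.symm_trans_self _) (Equiv.symm_trans_self _)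
  comp_inv s := UHom.ext (Equiv.self_trans_symm _) (Equiv.self_trans_symm _)

instance : Groupoid (VPt.{w} κ) where
  Hom X Y := VHom X Y
  id X := ⟨UHom.id X.toUPt, rfl⟩
  comp s t := ⟨UHom.comp s.toUHom t.toUHom, (congrArg t.ρ s.map_a).trans t.map_a⟩
  inv s := ⟨UHom.inv s.toUHom, (Equiv.symm_apply_eq _).2 s.map_a.symm⟩
  inv_comp s := VHom.ext (Equiv.symm_trans_self _) (Equiv.symm_trans_self _)
  comp_inv s := VHom.ext (Equiv.self_trans_symm _) (Equiv.self_trans_symm _)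

/-- The involution `(A, B, φ) ↦ (B, A, φ⁻¹)`, `(ρ, τ) ↦ (τ, ρ)`. -/
def uInv : UPt.{w} κ ⥤ UPt.{w} κ where
  obj X := ⟨X.B, X.A, X.hB, X.hA, X.φ.symm⟩
  map {X Y} s := ⟨s.τ, s.ρ, fun x => by
    have h := s.comm (X.φ.symm x)
    rw [Equiv.apply_symm_apply] at h
    exact (Equiv.symm_apply_eq _).2 h.symm⟩
  map_id _ := rfl
  map_comp _ _ := rfl

/-- The involution `(A, B, φ, a) ↦ (B, A, φ⁻¹, φ a)`, `(ρ, τ) ↦ (τ, ρ)`. -/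
def vInv : VPt.{w} κ ⥤ VPt.{w} κ where
  obj X := ⟨uInv.obj X.toUPt, X.φ X.a⟩
  map {X Y} s := ⟨uInv.map s.toUHom, by
    change s.τ (X.φ X.a) = Y.φ Y.a
    rw [← s.map_a, s.comm]⟩
  map_id _ := rfl
  map_comp _ _ := rfl

theorem vHom_heq {X X' Y Y' : VPt.{w} κ} (s : X ⟶ Y) (s' : X' ⟶ Y')
    (hX : X = X') (hY : Y = Y') (h : HEq (VHom.toUHom s) (VHom.toUHom s')) : HEq s s' := by
  subst hX hY
  exact heq_of_eq (VHom.ext (congrArg UHom.ρ (eq_of_heq h)) (congrArg UHom.τ (eq_of_heq h)))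

theorem vInv_vInv_obj (X : VPt.{w} κ) : vInv.obj (vInv.obj X) = X := by
  obtain ⟨⟨A, B, hA, hB, φ⟩, a⟩ := X
  simp [vInv, uInv]

variable (κ)

/-- The universe `U`. -/
def U : InvGpd.{w + 1} where
  carrier := UPt.{w} κ
  inv := uInv
  inv_inv := rfl

/-- The universe `Ũ` of pointed types. -/
def UTilde : InvGpd.{w + 1} where
  carrier := VPt.{w} κ
  inv := vInv
  inv_inv := Functor.hext vInv_vInv_obj fun X Y _ =>
    vHom_heq _ _ (vInv_vInv_obj X) (vInv_vInv_obj Y) HEq.rfl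

/-- The projection `p : Ũ ⟶ U`. -/
def p : UTilde.{w} κ ⟶ U.{w} κ where
  functor :=
    { obj := VPt.toUPt
      map := VHom.toUHom
      map_id := fun _ => rfl
      map_comp := fun _ _ => rfl }
  comm := rfl

end Universe

end InvGpd

end TTFib

open TTFib TTFib.InvGpd

/-! The key fact is that `p` is a discrete fibration: the fibre over `(A, B, φ)` is the set `A`, so
isomorphisms of `U` lift uniquely. Vertical paths in `Ũ` are therefore constant and `δ₁ : Ũ ⟶ P_U Ũ`
is invertible (`isIso_δ₁`). With such identity types an equivalence between pullbacks of `p` is just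
an isomorphism over the base. Acting on fibres, it amounts to an equivariant family of isomorphisms
between points of `U`, that is, to a map into `P_1 U` (`isGenericIso`). So `P_1 U` serves as `E`,
and the identity equivalence is classified by `δ₁`, in both structures.

The structures differ in whether this `δ₁` is an acyclic cofibration. In the injective one it is,
because it is an equivalence that is injective on objects; an acyclic cofibration between fibrant
objects is a right homotopy equivalence. It remains to prove fibrancy. Discrete fibrations are
injective fibrations, uniqueness of lifts supplying equivariance (`IsDiscreteFibration.injFib`);
this covers `p` and `δ₂`. For `U`, an extension along an acyclic cofibration is first found up to
coherent isomorphism (`exists_pseudoEquivariant_extension`), and the isomorphism stored in a point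
of `U` absorbs the coherence (`injFibrant_U`).

In the projective structure, maps with the left lifting property hit every fixed object
(`exists_of_llp_projFib`), so right homotopic maps agree on fixed objects and a right homotopy
equivalence is surjective on them. Negation on a two-element set is a fixed point of `E` that is not
an identity equivalence, so univalence fails. -/

namespace TTFib

/-! ### Homotopy equivalences and objects of equivalences in a general category -/

section General

variable {C : Type u} [Category.{v} C]

theorem IsPathObject.rightHomotopic_refl {Fib : MorphismProperty C} {T Y P : C} {hT : IsTerminal T}
    {r : Y ⟶ P} {d₀ d₁ : P ⟶ Y} (hP : IsPathObject Fib (hT.from Y) r d₀ d₁) {X : C} (f : X ⟶ Y) :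
    RightHomotopic Fib f f :=
  ⟨T, hT, P, r, d₀, d₁, f ≫ r, hP, by simp [hP.r_d₀], by simp [hP.r_d₁]⟩

/-- An acyclic cofibration between fibrant objects is a right homotopy equivalence. -/
theorem isRightHomotopyEquiv_of_llp {Fib : MorphismProperty C} {T : C} (hT : IsTerminal T)
    {X Y PX PY : C} {f : X ⟶ Y} (hf : Fib.llp f) (hX : Fib (hT.from X))
    {rX : X ⟶ PX} {a₀ a₁ : PX ⟶ X} (hPX : IsPathObject Fib (hT.from X) rX a₀ a₁)
    {rY : Y ⟶ PY} {b₀ b₁ : PY ⟶ Y} (hPY : IsPathObject Fib (hT.from Y) rY b₀ b₁) :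
    IsRightHomotopyEquiv Fib f := by
  -- Fibrancy of `X` gives a strict retraction of `f`.
  have sq : CommSq (𝟙 X) f (hT.from X) (hT.from Y) := ⟨hT.hom_ext _ _⟩
  have := hf _ hX
  have hg : f ≫ sq.lift = 𝟙 X := sq.fac_left
  obtain ⟨W, fst, snd, hW, hfib⟩ := hPY.fibration
  have hw : (sq.lift ≫ f) ≫ hT.from Y = 𝟙 Y ≫ hT.from Y := hT.hom_ext _ _
  -- The other homotopy is constant along `f`; it extends to `Y` by lifting against the endpoint
  -- fibration.
  have sq' : CommSq (f ≫ rY) f (hW.lift b₀ b₁ hPY.comm) (hW.lift (sq.lift ≫ f) (𝟙 Y) hw) := by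
    refine ⟨hW.hom_ext ?_ ?_⟩
    · simp [hPY.r_d₀]
    · simp [hPY.r_d₁]
  have := hf _ hfib
  refine ⟨sq.lift, ?_, T, hT, PY, rY, b₀, b₁, sq'.lift, hPY, ?_, ?_⟩
  · rw [hg]
    exact hPX.rightHomotopic_refl _
  · have := congrArg (· ≫ fst) sq'.fac_right
    simpa only [Category.assoc, IsPullback.lift_fst] using this
  · have := congrArg (· ≫ snd) sq'.fac_right
    simpa only [Category.assoc, IsPullback.lift_snd] using this

variable {V U P : C} {p : V ⟶ U} {d₀ d₁ : P ⟶ V}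

theorem EquivOver.IsRestriction.self {T : C} {a b : T ⟶ U} {S₁ : PullbackOf p a}
    {S₂ : PullbackOf p b} (e : EquivOver p d₀ d₁ S₁ S₂) : e.IsRestriction (𝟙 T) e :=
  ⟨by simp, by simp, 𝟙 _, 𝟙 _, by simp⟩

theorem EquivOver.IsRestriction.trans {T T' T'' : C} {a b : T ⟶ U} {a' b' : T' ⟶ U}
    {a'' b'' : T'' ⟶ U} {S₁ : PullbackOf p a} {S₂ : PullbackOf p b} {S₁' : PullbackOf p a'}
    {S₂' : PullbackOf p b'} {S₁'' : PullbackOf p a''} {S₂'' : PullbackOf p b''}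
    {e : EquivOver p d₀ d₁ S₁ S₂} {e' : EquivOver p d₀ d₁ S₁' S₂'}
    {e'' : EquivOver p d₀ d₁ S₁'' S₂''} {t : T' ⟶ T} {s : T'' ⟶ T'}
    (h : e.IsRestriction t e') (h' : e'.IsRestriction s e'') : e.IsRestriction (s ≫ t) e'' := by
  obtain ⟨ha, hb, c₁, c₂, h₁, h₂, h₃, h₄, hf, hg, hH, hh, hK⟩ := h
  obtain ⟨ha', hb', c₁', c₂', h₁', h₂', h₃', h₄', hf', hg', hH', hh', hK'⟩ := h'
  refine ⟨by rw [Category.assoc, ha, ha'], by rw [Category.assoc, hb, hb'], c₁' ≫ c₁, c₂' ≫ c₂,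
    by simp [h₁, h₁'], by simp [h₂, reassoc_of% h₂'], by simp [h₃, h₃'],
    by simp [h₄, reassoc_of% h₄'], by simp [← hf, reassoc_of% hf'],
    by simp [← hg, reassoc_of% hg'], by simp [← hH, hH'],
    by simp [← hh, reassoc_of% hh'], by simp [← hK, hK']⟩

theorem EquivObject.isRestriction_idMap (𝓔 : EquivObject p d₀ d₁) (r : V ⟶ P)
    (h₀ : r ≫ d₀ = 𝟙 V) (h₁ : r ≫ d₁ = 𝟙 V) :
    𝓔.generic.IsRestriction (𝓔.idMap r h₀ h₁) (EquivOver.refl p r d₀ d₁ h₀ h₁) :=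
  (𝓔.existsUnique _ _ (EquivOver.refl p r d₀ d₁ h₀ h₁)).choose_spec.1

theorem EquivObject.idMap_eq (𝓔 : EquivObject p d₀ d₁) {r : V ⟶ P}
    {h₀ : r ≫ d₀ = 𝟙 V} {h₁ : r ≫ d₁ = 𝟙 V} {t : U ⟶ 𝓔.E}
    (ht : 𝓔.generic.IsRestriction t (EquivOver.refl p r d₀ d₁ h₀ h₁)) :
    𝓔.idMap r h₀ h₁ = t :=
  (𝓔.existsUnique _ _ (EquivOver.refl p r d₀ d₁ h₀ h₁)).unique
    (𝓔.isRestriction_idMap r h₀ h₁) ht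

/-- Any two objects of equivalences are isomorphic, compatibly with their structure maps. -/
theorem EquivObject.exists_iso (𝓔 𝓕 : EquivObject p d₀ d₁) :
    ∃ θ : 𝓔.E ≅ 𝓕.E, θ.hom ≫ 𝓕.e₀ = 𝓔.e₀ ∧ θ.hom ≫ 𝓕.e₁ = 𝓔.e₁ ∧
      ∀ (r : V ⟶ P) (h₀ : r ≫ d₀ = 𝟙 V) (h₁ : r ≫ d₁ = 𝟙 V),
        𝓔.idMap r h₀ h₁ ≫ θ.hom = 𝓕.idMap r h₀ h₁ := by
  obtain ⟨t, ht, -⟩ := 𝓕.existsUnique _ _ 𝓔.generic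
  obtain ⟨s, hs, -⟩ := 𝓔.existsUnique _ _ 𝓕.generic
  refine ⟨⟨t, s, ?_, ?_⟩, ht.1, ht.2.1, fun r h₀ h₁ => ?_⟩
  · exact (𝓔.existsUnique _ _ 𝓔.generic).unique (hs.trans ht) (.self _)
  · exact (𝓕.existsUnique _ _ 𝓕.generic).unique (ht.trans hs) (.self _)
  · exact (𝓕.idMap_eq (ht.trans (𝓔.isRestriction_idMap r h₀ h₁))).symm

/-- A fibrewise isomorphism, as an equivalence with constant homotopies. -/
def EquivOver.ofIso (r : V ⟶ P) (h₀ : r ≫ d₀ = 𝟙 V) (h₁ : r ≫ d₁ = 𝟙 V) {T : C} {a b : T ⟶ U}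
    {S₁ : PullbackOf p a} {S₂ : PullbackOf p b} (φ : S₁.X ≅ S₂.X)
    (hφ : φ.hom ≫ S₂.left = S₁.left) : EquivOver p d₀ d₁ S₁ S₂ where
  f := φ.hom
  f_left := hφ
  g := φ.inv
  g_left := by rw [← hφ, φ.inv_hom_id_assoc]
  H := S₁.top ≫ r
  H_d₀ := by simp [h₀]
  H_d₁ := by simp [h₁]
  h := φ.inv
  h_left := by rw [← hφ, φ.inv_hom_id_assoc]
  K := S₂.top ≫ r
  K_d₀ := by simp [h₀]
  K_d₁ := by simp [h₁]

/-! ### Equivalences when all fibrewise paths are constant -/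

section IsIso

variable {r : V ⟶ P} (h₀ : r ≫ d₀ = 𝟙 V) (h₁ : r ≫ d₁ = 𝟙 V) [IsIso r]

include h₀ h₁

/-- Both endpoint maps are the inverse of `r`, so a homotopy has equal ends and carries no
information. -/
theorem comp_eq_of_isIso {X : C} {H : X ⟶ P} {x y : X ⟶ V} (hx : H ≫ d₀ = x) (hy : H ≫ d₁ = y) :
    x = y ∧ H = x ≫ r := by
  have e₀ : d₀ = inv r := by rw [← cancel_epi r, h₀, IsIso.hom_inv_id]
  have e₁ : d₁ = inv r := by rw [← cancel_epi r, h₁, IsIso.hom_inv_id]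
  rw [← hx, ← hy, e₀, e₁]
  simp

variable {T : C} {a b : T ⟶ U} {S₁ : PullbackOf p a} {S₂ : PullbackOf p b}
  (e : EquivOver p d₀ d₁ S₁ S₂)

theorem EquivOver.f_g : e.f ≫ e.g = 𝟙 _ := by
  apply S₁.isPullback.hom_ext
  · have := (comp_eq_of_isIso h₀ h₁ e.H_d₀ e.H_d₁).1
    simpa using this
  · simp [e.g_left, e.f_left]

theorem EquivOver.h_f : e.h ≫ e.f = 𝟙 _ := by
  apply S₂.isPullback.hom_ext
  · have := (comp_eq_of_isIso h₀ h₁ e.K_d₀ e.K_d₁).1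
    simpa using this
  · simp [e.h_left, e.f_left]

theorem EquivOver.h_eq_g : e.h = e.g := by
  have := congrArg (· ≫ e.g) (e.h_f h₀ h₁)
  simpa [e.f_g h₀ h₁] using this

/-- If the reflexivity map is invertible then so are all equivalences. -/
def EquivOver.iso : S₁.X ≅ S₂.X where
  hom := e.f
  inv := e.g
  hom_inv_id := e.f_g h₀ h₁
  inv_hom_id := by rw [← e.h_eq_g h₀ h₁, e.h_f h₀ h₁]

theorem EquivOver.H_eq : e.H = S₁.top ≫ r := by
  have := comp_eq_of_isIso h₀ h₁ e.H_d₀ e.H_d₁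
  rw [this.2, this.1]

theorem EquivOver.K_eq : e.K = S₂.top ≫ r := by
  have := comp_eq_of_isIso h₀ h₁ e.K_d₀ e.K_d₁
  rw [this.2, this.1]

/-- The map `f` determines its inverses and the homotopies, and the second comparison map is forced
by the pullback `S₂`; only the condition on `f` survives. -/
theorem EquivOver.isRestriction_iff {T' : C} {a' b' : T' ⟶ U} {S₁' : PullbackOf p a'}
    {S₂' : PullbackOf p b'} (e' : EquivOver p d₀ d₁ S₁' S₂') (t : T' ⟶ T) :
    e.IsRestriction t e' ↔ t ≫ a = a' ∧ t ≫ b = b' ∧ ∃ c : S₁'.X ⟶ S₁.X,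
      c ≫ S₁.top = S₁'.top ∧ c ≫ S₁.left = S₁'.left ≫ t ∧
      e'.f ≫ S₂'.top = c ≫ e.f ≫ S₂.top := by
  constructor
  · rintro ⟨ha, hb, c₁, c₂, h1, h2, h3, h4, hf, -⟩
    exact ⟨ha, hb, c₁, h1, h2, by rw [← h3, reassoc_of% hf]⟩
  · rintro ⟨ha, hb, c₁, h1, h2, hf⟩
    have hw : S₂'.top ≫ p = (S₂'.left ≫ t) ≫ b := by
      rw [S₂'.isPullback.w, Category.assoc, hb]
    have hf' : e'.f ≫ S₂.isPullback.lift S₂'.top (S₂'.left ≫ t) hw = c₁ ≫ e.f := by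
      apply S₂.isPullback.hom_ext
      · simp [hf]
      · rw [Category.assoc, IsPullback.lift_snd, Category.assoc, e.f_left, h2,
          reassoc_of% e'.f_left]
    have hg' : e'.g ≫ c₁ = S₂.isPullback.lift S₂'.top (S₂'.left ≫ t) hw ≫ e.g := by
      rw [← cancel_epi (e'.iso h₀ h₁).hom]
      change e'.f ≫ _ = e'.f ≫ _
      rw [reassoc_of% e'.f_g h₀ h₁, reassoc_of% hf', e.f_g h₀ h₁, Category.comp_id]
    refine ⟨ha, hb, c₁, S₂.isPullback.lift _ _ hw, h1, h2, by simp, by simp, hf', hg', ?_, ?_, ?_⟩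
    · rw [e.H_eq h₀ h₁, e'.H_eq h₀ h₁, ← h1, Category.assoc]
    · rw [e.h_eq_g h₀ h₁, e'.h_eq_g h₀ h₁, hg']
    · rw [e.K_eq h₀ h₁, e'.K_eq h₀ h₁]
      simp

end IsIso

/-- Every fibrewise isomorphism `ψ` is the pullback of `φ` along a unique map: the universal property of a generic
fibrewise isomorphism between pullbacks of `p`. -/
def IsGenericIso {E : C} {e₀ e₁ : E ⟶ U} (S₁ : PullbackOf p e₀) (S₂ : PullbackOf p e₁)
    (φ : S₁.X ≅ S₂.X) : Prop :=
  ∀ ⦃T : C⦄ ⦃a b : T ⟶ U⦄ (S₁' : PullbackOf p a) (S₂' : PullbackOf p b) (ψ : S₁'.X ≅ S₂'.X),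
    ψ.hom ≫ S₂'.left = S₁'.left → ∃! t : T ⟶ E, t ≫ e₀ = a ∧ t ≫ e₁ = b ∧
      ∃ c : S₁'.X ⟶ S₁.X, c ≫ S₁.top = S₁'.top ∧ c ≫ S₁.left = S₁'.left ≫ t ∧
        ψ.hom ≫ S₂'.top = c ≫ φ.hom ≫ S₂.top

/-- If the reflexivity map is invertible then the object of isomorphisms is an object of
equivalences. -/
def EquivObject.ofIsGenericIso {r : V ⟶ P} (h₀ : r ≫ d₀ = 𝟙 V) (h₁ : r ≫ d₁ = 𝟙 V) [IsIso r]
    {E : C} {e₀ e₁ : E ⟶ U} {S₁ : PullbackOf p e₀} {S₂ : PullbackOf p e₁}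
    {φ : S₁.X ≅ S₂.X} (hφ : φ.hom ≫ S₂.left = S₁.left) (huniv : IsGenericIso S₁ S₂ φ) :
    EquivObject p d₀ d₁ where
  E := E
  e₀ := e₀
  e₁ := e₁
  S₁ := S₁
  S₂ := S₂
  generic := EquivOver.ofIso r h₀ h₁ φ hφ
  existsUnique S₁' S₂' e := by
    simp only [EquivOver.isRestriction_iff h₀ h₁]
    exact huniv S₁' S₂' (e.iso h₀ h₁) e.f_left

end General

/-! ### Full subcategories -/

section Full

variable {C : Type u} [Category.{v} C] {Q : ObjectProperty C}

theorem hasLiftingProperty_of_ι {A B X Y : Q.FullSubcategory} {i : A ⟶ B} {f : X ⟶ Y}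
    (h : HasLiftingProperty i.hom f.hom) : HasLiftingProperty i f where
  sq_hasLift {g k} sq := by
    have sq' : CommSq g.hom i.hom f.hom k.hom := sq.map Q.ι
    exact ⟨⟨⟨ObjectProperty.homMk sq'.lift, Q.hom_ext sq'.fac_left, Q.hom_ext sq'.fac_right⟩⟩⟩

theorem llp_inverseImage_ι {W : MorphismProperty C} {A B : Q.FullSubcategory} {i : A ⟶ B}
    (h : W.llp i.hom) : (W.inverseImage Q.ι).llp i :=
  fun _ _ _ hf => hasLiftingProperty_of_ι (h _ hf)

theorem isPullback_of_ι {A B X Y : Q.FullSubcategory} {t : A ⟶ B} {l : A ⟶ X} {r : B ⟶ Y}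
    {b : X ⟶ Y} (h : IsPullback t.hom l.hom r.hom b.hom) : IsPullback t l r b :=
  IsPullback.of_map Q.ι (Q.hom_ext h.w) h

/-- The inclusion preserves pullbacks that can be computed by objects of the subcategory. -/
theorem isPullback_ι {A B X Y : Q.FullSubcategory} {t : A ⟶ B} {l : A ⟶ X} {r : B ⟶ Y}
    {b : X ⟶ Y} (h : IsPullback t l r b) {A' : C} {t' : A' ⟶ B.obj} {l' : A' ⟶ X.obj}
    (h' : IsPullback t' l' r.hom b.hom) (hA' : Q A') : IsPullback t.hom l.hom r.hom b.hom := by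
  have hp : IsPullback (ObjectProperty.homMk t' : (⟨A', hA'⟩ : Q.FullSubcategory) ⟶ B)
    (ObjectProperty.homMk l') r b := isPullback_of_ι h'
  refine h'.of_iso (Q.ι.mapIso (hp.isoIsPullback _ _ h)) (Iso.refl _) (Iso.refl _) (Iso.refl _)
    ?_ ?_ (by simp) (by simp)
  · have := congrArg (fun k => k.hom) (hp.isoIsPullback_hom_fst _ _ h)
    simp only [Iso.refl_hom, Category.comp_id]
    exact this.symm
  · have := congrArg (fun k => k.hom) (hp.isoIsPullback_hom_snd _ _ h)
    simp only [Iso.refl_hom, Category.comp_id]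
    exact this.symm

/-- A pullback in the full subcategory. -/
def PullbackOf.lift {V U E : Q.FullSubcategory} {p : V ⟶ U} {e : E ⟶ U}
    (S : PullbackOf p.hom e.hom) (hS : Q S.X) : PullbackOf p e where
  X := ⟨S.X, hS⟩
  top := ObjectProperty.homMk S.top
  left := ObjectProperty.homMk S.left
  isPullback := isPullback_of_ι S.isPullback

/-- The hypothesis `hp` ensures that pullbacks of `p` taken in the subcategory are still pullbacks
in `C`, where genericity is known. -/
theorem IsGenericIso.lift {V U E : Q.FullSubcategory} {p : V ⟶ U} {e₀ e₁ : E ⟶ U}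
    {S₁ : PullbackOf p.hom e₀.hom} {S₂ : PullbackOf p.hom e₁.hom} {φ : S₁.X ≅ S₂.X}
    (h : IsGenericIso S₁ S₂ φ) (hS₁ : Q S₁.X) (hS₂ : Q S₂.X)
    (hp : ∀ {T : C} (a : T ⟶ U.obj), Q T → ∃ S : PullbackOf p.hom a, Q S.X) :
    IsGenericIso (S₁.lift hS₁) (S₂.lift hS₂) (Q.isoMk φ) := by
  intro T a b S₁' S₂' ψ hψ
  obtain ⟨Sa, hSa⟩ := hp a.hom T.property
  obtain ⟨Sb, hSb⟩ := hp b.hom T.property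
  obtain ⟨t, ⟨h0, h1, c, hc1, hc2, hc3⟩, ht⟩ :=
    h ⟨S₁'.X.obj, S₁'.top.hom, S₁'.left.hom, isPullback_ι S₁'.isPullback Sa.isPullback hSa⟩
      ⟨S₂'.X.obj, S₂'.top.hom, S₂'.left.hom, isPullback_ι S₂'.isPullback Sb.isPullback hSb⟩
      (Q.ι.mapIso ψ) (congrArg (fun k => k.hom) hψ)
  refine ⟨ObjectProperty.homMk t, ⟨Q.hom_ext h0, Q.hom_ext h1, ObjectProperty.homMk c,
    Q.hom_ext hc1, Q.hom_ext hc2, Q.hom_ext hc3⟩, ?_⟩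
  rintro s ⟨k0, k1, d, hd1, hd2, hd3⟩
  exact Q.hom_ext (ht s.hom ⟨congrArg (fun k => k.hom) k0, congrArg (fun k => k.hom) k1, d.hom,
    congrArg (fun k => k.hom) hd1, congrArg (fun k => k.hom) hd2, congrArg (fun k => k.hom) hd3⟩)

end Full

end TTFib

/-! ### The category of groupoids with involution -/

namespace TTFib

namespace InvGpd

variable {A B C X Y Z : InvGpd.{u}}

theorem hom_ext {f g : X ⟶ Y} (h : f.functor = g.functor) : f = g := Hom.ext h

theorem inv_inv_obj (x : X.carrier) : X.inv.obj (X.inv.obj x) = x :=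
  Functor.congr_obj X.inv_inv x

theorem obj_inv (f : X ⟶ Y) (x : X.carrier) :
    f.functor.obj (X.inv.obj x) = Y.inv.obj (f.functor.obj x) :=
  Functor.congr_obj f.comm x

theorem map_inv (f : X ⟶ Y) {x x' : X.carrier} (g : x ⟶ x') :
    f.functor.map (X.inv.map g) =
      eqToHom (obj_inv f x) ≫ Y.inv.map (f.functor.map g) ≫ eqToHom (obj_inv f x').symm :=
  Functor.congr_hom f.comm g

theorem map_inv_inv {x x' : X.carrier} (g : x ⟶ x') :
    X.inv.map (X.inv.map g) = eqToHom (inv_inv_obj x) ≫ g ≫ eqToHom (inv_inv_obj x').symm :=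
  Functor.congr_hom X.inv_inv g

/-! ### The terminal object -/

theorem toOne_unique (f g : X ⟶ one.{u}) : f = g :=
  hom_ext (CategoryTheory.Functor.ext (fun _ => Subsingleton.elim (α := Discrete PUnit) _ _)
    fun _ _ _ => Subsingleton.elim (α := Discrete.mk PUnit.unit ⟶ Discrete.mk PUnit.unit) _ _)

/-! ### Pullbacks -/

section Pullback

variable (f : X ⟶ Z) (g : Y ⟶ Z)

structure PbPt where
  x : X.carrier
  y : Y.carrier
  w : f.functor.obj x = g.functor.obj y

@[ext]
structure PbHom (P Q : PbPt f g) where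
  m : P.x ⟶ Q.x
  n : P.y ⟶ Q.y
  w : f.functor.map m ≫ eqToHom Q.w = eqToHom P.w ≫ g.functor.map n

instance : Groupoid (PbPt f g) where
  Hom P Q := PbHom f g P Q
  id P := ⟨𝟙 _, 𝟙 _, by simp⟩
  comp s t := ⟨s.m ≫ t.m, s.n ≫ t.n, by
    rw [Functor.map_comp, Functor.map_comp, Category.assoc, t.w, reassoc_of% s.w]⟩
  id_comp _ := PbHom.ext (Category.id_comp _) (Category.id_comp _)
  comp_id _ := PbHom.ext (Category.comp_id _) (Category.comp_id _)
  assoc _ _ _ := PbHom.ext (Category.assoc _ _ _) (Category.assoc _ _ _)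
  inv s := ⟨Groupoid.inv s.m, Groupoid.inv s.n, by
    simp only [Groupoid.inv_eq_inv, Functor.map_inv, IsIso.inv_comp_eq]
    rw [reassoc_of% s.w, IsIso.hom_inv_id, Category.comp_id]⟩
  inv_comp _ := PbHom.ext (Groupoid.inv_comp _) (Groupoid.inv_comp _)
  comp_inv _ := PbHom.ext (Groupoid.comp_inv _) (Groupoid.comp_inv _)

def pbFst : PbPt f g ⥤ X.carrier where
  obj := PbPt.x
  map := PbHom.m
  map_id _ := rfl
  map_comp _ _ := rfl

def pbSnd : PbPt f g ⥤ Y.carrier where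
  obj := PbPt.y
  map := PbHom.n
  map_id _ := rfl
  map_comp _ _ := rfl

variable {f g}

theorem pbPt_ext {P Q : PbPt f g} (hx : P.x = Q.x) (hy : P.y = Q.y) : P = Q := by
  obtain ⟨x, y, w⟩ := P
  obtain ⟨x', y', w'⟩ := Q
  cases hx
  cases hy
  rfl

theorem pbHom_heq {P P' Q Q' : PbPt f g} (s : P ⟶ Q) (s' : P' ⟶ Q') (hP : P = P') (hQ : Q = Q')
    (hm : HEq (PbHom.m s) (PbHom.m s')) (hn : HEq (PbHom.n s) (PbHom.n s')) : HEq s s' := by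
  subst hP hQ
  exact heq_of_eq (PbHom.ext (eq_of_heq hm) (eq_of_heq hn))

theorem pbFunctor_ext {D : Type*} [Category D] {F G : D ⥤ PbPt f g}
    (h₁ : F ⋙ pbFst f g = G ⋙ pbFst f g) (h₂ : F ⋙ pbSnd f g = G ⋙ pbSnd f g) : F = G :=
  have h (d : D) : F.obj d = G.obj d := pbPt_ext (Functor.congr_obj h₁ d) (Functor.congr_obj h₂ d)
  Functor.hext h fun _ _ k => pbHom_heq _ _ (h _) (h _) (Functor.hcongr_hom h₁ k)
    (Functor.hcongr_hom h₂ k)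

theorem isPullback_comm_functor {D : Type*} [Category D] {s : D ⥤ X.carrier} {t : D ⥤ Y.carrier}
    (h : s ⋙ f.functor = t ⋙ g.functor) {d d' : D} (k : d ⟶ d') :
    f.functor.map (s.map k) ≫ eqToHom (Functor.congr_obj h d') =
      eqToHom (Functor.congr_obj h d) ≫ g.functor.map (t.map k) := by
  have := Functor.congr_hom h k
  simp only [Functor.comp_map] at this
  rw [this]
  simp

def pbLiftFunctor {D : Type*} [Category D] (s : D ⥤ X.carrier) (t : D ⥤ Y.carrier)
    (h : s ⋙ f.functor = t ⋙ g.functor) : D ⥤ PbPt f g where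
  obj d := ⟨s.obj d, t.obj d, Functor.congr_obj h d⟩
  map k := ⟨s.map k, t.map k, isPullback_comm_functor h k⟩
  map_id _ := PbHom.ext (s.map_id _) (t.map_id _)
  map_comp _ _ := PbHom.ext (s.map_comp _ _) (t.map_comp _ _)

theorem pbFst_comp : pbFst f g ⋙ f.functor = pbSnd f g ⋙ g.functor :=
  CategoryTheory.Functor.ext (fun P : PbPt f g => P.w) fun P Q k => by
    have h := congrArg (· ≫ eqToHom Q.w.symm) (PbHom.w k)
    simp only [Category.assoc, eqToHom_trans, eqToHom_refl, Category.comp_id] at h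
    exact h

variable (f g)

/-- The pullback of equivariant functors. -/
def pb : InvGpd.{u} where
  carrier := PbPt f g
  inv := pbLiftFunctor (pbFst f g ⋙ X.inv) (pbSnd f g ⋙ Y.inv) (by
    rw [Functor.assoc, f.comm, Functor.assoc, g.comm, ← Functor.assoc, pbFst_comp,
      Functor.assoc])
  inv_inv := pbFunctor_ext (by
      change pbFst f g ⋙ (X.inv ⋙ X.inv) = _
      rw [X.inv_inv]; rfl) (by
      change pbSnd f g ⋙ (Y.inv ⋙ Y.inv) = _
      rw [Y.inv_inv]; rfl)

def fst : pb f g ⟶ X := ⟨pbFst f g, rfl⟩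

def snd : pb f g ⟶ Y := ⟨pbSnd f g, rfl⟩

variable {f g}

def pbLift (s : A ⟶ X) (t : A ⟶ Y) (h : s ≫ f = t ≫ g) : A ⟶ pb f g where
  functor := pbLiftFunctor s.functor t.functor (congrArg Hom.functor h)
  comm := pbFunctor_ext s.comm t.comm

theorem pb_hom_ext {k l : A ⟶ pb f g} (h₁ : k ≫ fst f g = l ≫ fst f g)
    (h₂ : k ≫ snd f g = l ≫ snd f g) : k = l :=
  hom_ext (pbFunctor_ext (congrArg Hom.functor h₁) (congrArg Hom.functor h₂))

variable (f g) in
theorem isPullback_pb : IsPullback (fst f g) (snd f g) f g :=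
  ⟨⟨hom_ext pbFst_comp⟩, ⟨PullbackCone.IsLimit.mk _
    (fun s => pbLift s.fst s.snd s.condition) (fun _ => rfl) (fun _ => rfl)
    fun _ _ h₁ h₂ => pb_hom_ext h₁ h₂⟩⟩

end Pullback

/-! ### Discrete fibrations -/

/-- A functor between groupoids for which isomorphisms lift uniquely. -/
structure IsDiscreteFibration {D E : Type*} [Category D] [Category E] (F : D ⥤ E) : Prop where
  exists_lift (x : D) {y : E} (g : F.obj x ⟶ y) :
    ∃ (x' : D) (γ : x ⟶ x') (h : F.obj x' = y), F.map γ = g ≫ eqToHom h.symm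
  unique {x x' : D} (γ : x ⟶ x') (h : F.obj x = F.obj x') :
    F.map γ = eqToHom h → ∃ h' : x = x', γ = eqToHom h'

theorem IsDiscreteFibration.projFib {f : X ⟶ Y} (hf : IsDiscreteFibration f.functor) :
    projFib f :=
  fun x _ g => hf.exists_lift x g

section Discrete

variable {D E K : Type*} [Groupoid D] [Groupoid E] [Category K] {F : D ⥤ E}

/-- The composite `α ≫ β⁻¹` lies over an identity, hence is one. -/
theorem IsDiscreteFibration.map_injective (hF : IsDiscreteFibration F) {x x' : D} {α β : x ⟶ x'}
    (h : F.map α = F.map β) : α = β := by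
  obtain ⟨_, h'⟩ := hF.unique (α ≫ Groupoid.inv β) rfl (by simp [h])
  simpa [Groupoid.inv_eq_inv, IsIso.comp_inv_eq] using h'

/-- Two lifts of a functor along a discrete fibration agree if they are connected by a family of
morphisms lying over identities. -/
theorem IsDiscreteFibration.functor_eq (hF : IsDiscreteFibration F) {s t : K ⥤ D}
    (h : s ⋙ F = t ⋙ F) (η : ∀ k, s.obj k ⟶ t.obj k)
    (hη : ∀ k, F.map (η k) = eqToHom (Functor.congr_obj h k)) : s = t := by
  refine CategoryTheory.Functor.ext (fun k : K => (hF.unique _ _ (hη k)).choose) fun k k' g => ?_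
  apply hF.map_injective
  have := Functor.congr_hom h g
  simpa [eqToHom_map] using this

theorem IsDiscreteFibration.functor_eq_of_obj (hF : IsDiscreteFibration F) {s t : K ⥤ D}
    (h : s ⋙ F = t ⋙ F) (hobj : ∀ k, s.obj k = t.obj k) : s = t :=
  hF.functor_eq h (fun k => eqToHom (hobj k)) fun k => by simp [eqToHom_map]

/-- Two lifts of a functor along a discrete fibration agree if they agree after restriction along
an essentially surjective functor. -/
theorem IsDiscreteFibration.functor_eq_of_essSurj (hF : IsDiscreteFibration F) {J : Type*}
    [Category J] (i : J ⥤ K) [i.EssSurj] {s t : K ⥤ D} (hi : i ⋙ s = i ⋙ t)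
    (h : s ⋙ F = t ⋙ F) : s = t := by
  -- Each `k` is isomorphic to some `i j`, where `s` and `t` agree; conjugating yields a morphism
  -- over the identity.
  refine hF.functor_eq h (fun k => s.map (i.objObjPreimageIso k).inv ≫
    eqToHom (Functor.congr_obj hi _) ≫ t.map (i.objObjPreimageIso k).hom) fun k => ?_
  have := Functor.congr_hom h (i.objObjPreimageIso k).inv
  simp only [Functor.comp_map] at this
  have ht : F.map (t.map (i.objObjPreimageIso k).inv) ≫
      F.map (t.map (i.objObjPreimageIso k).hom) = 𝟙 _ := by
    rw [← F.map_comp, ← t.map_comp, Iso.inv_hom_id, t.map_id, F.map_id]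
  rw [F.map_comp, F.map_comp, eqToHom_map, this]
  simp [ht]

end Discrete

end InvGpd
end TTFib

/-! ### Lifting along injective acyclic cofibrations -/

namespace TTFib

namespace InvGpd

variable {A B C X Y Z : InvGpd.{u}}

/-- An equivalence that is injective on objects has a strict retraction, which is also a
quasi-inverse. -/
theorem exists_retraction {D E : Type*} [Groupoid D] [Groupoid E] (i : D ⥤ E) [i.IsEquivalence]
    (hi : Function.Injective i.obj) :
    ∃ (R : E ⥤ D) (ε : R ⋙ i ⟶ 𝟭 E) (h : i ⋙ R = 𝟭 D),
      ∀ d, ε.app (i.obj d) = eqToHom (congrArg i.obj (Functor.congr_obj h d)) := by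
  -- On the image of `i` the component is chosen to be an identity; with injectivity on objects this
  -- makes the retraction strict.
  have key (e : E) : ∃ (d : D) (β : i.obj d ⟶ e),
      ∀ d', i.obj d' = e → ∃ h : i.obj d = e, β = eqToHom h := by
    by_cases he : ∃ d, i.obj d = e
    · obtain ⟨d, hd⟩ := he
      exact ⟨d, eqToHom hd, fun _ _ => ⟨hd, rfl⟩⟩
    · exact ⟨i.objPreimage e, (i.objObjPreimageIso e).hom, fun d' hd' => (he ⟨d', hd'⟩).elim⟩
  choose r ε hε using key
  have hr (d : D) : r (i.obj d) = d := hi (hε _ d rfl).choose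
  let R : E ⥤ D :=
    { obj := r
      map := fun β => i.preimage (ε _ ≫ β ≫ CategoryTheory.inv (ε _))
      map_id := fun e => i.map_injective (by simp)
      map_comp := fun _ _ => i.map_injective (by simp) }
  have hR : i ⋙ R = 𝟭 D := CategoryTheory.Functor.ext hr fun d d' g => i.map_injective (by
    simp [R, (hε _ d rfl).choose_spec, (hε _ d' rfl).choose_spec, eqToHom_map])
  exact ⟨R, { app := ε, naturality := fun _ _ _ => by simp [R] }, hR,
    fun d => (hε _ d rfl).choose_spec⟩

/-- With `R` a strict retraction of `i` and `ε : i R ⟶ 1`, the diagonal at `b` is the end of the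
lift of `v (ε b)` starting at `u (R b)`. No equivariance of `R` is needed. -/
theorem IsDiscreteFibration.injFib {f : X ⟶ Y} (hf : IsDiscreteFibration f.functor) :
    injFib f := by
  rintro A B i ⟨hi, hinj⟩
  refine ⟨fun {u v} sq => ?_⟩
  obtain ⟨R, ε, hR, hε⟩ := exists_retraction i.functor hinj
  have sqF : u.functor ⋙ f.functor = i.functor ⋙ v.functor := congrArg Hom.functor sq.w
  choose x' ξ hx hξ using fun b => hf.exists_lift (u.functor.obj (R.obj b))
    (eqToHom (Functor.congr_obj sqF (R.obj b)) ≫ v.functor.map (ε.app b))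
  let w : B.carrier ⥤ X.carrier :=
    { obj := x'
      map := fun {b b'} β => CategoryTheory.inv (ξ b) ≫ u.functor.map (R.map β) ≫ ξ b'
      map_id := by simp
      map_comp := by simp }
  have hwf : w ⋙ f.functor = v.functor := CategoryTheory.Functor.ext hx fun b b' β => by
    have h := Functor.congr_hom sqF (R.map β)
    have hn := congrArg v.functor.map (ε.naturality β)
    simp only [Functor.comp_map, Functor.id_map, Functor.map_comp] at h hn
    simp [w, hξ, h, reassoc_of% hn]
  have hwi : i.functor ⋙ w = u.functor := by
    refine hf.functor_eq (by rw [Functor.assoc, hwf, sqF]) (fun a =>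
      CategoryTheory.inv (ξ (i.functor.obj a)) ≫ u.functor.map (eqToHom (Functor.congr_obj hR a))) fun a => ?_
    simp [hξ, hε, eqToHom_map]
  refine ⟨⟨⟨⟨w, ?_⟩, hom_ext hwi, hom_ext hwf⟩⟩⟩
  -- Equivariance: `w` conjugated on either side lifts the same functor, and the two lifts agree
  -- along the essentially surjective `i`.
  apply hf.functor_eq_of_essSurj i.functor
  · rw [← Functor.assoc, ← Functor.assoc, ← i.comm, Functor.assoc, hwi, u.comm]
  · rw [Functor.assoc, Functor.assoc, hwf, f.comm, ← Functor.assoc, hwf, v.comm]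

theorem injFib_comp {f : X ⟶ Y} {g : Y ⟶ Z} (hf : injFib f) (hg : injFib g) : injFib (f ≫ g) :=
  MorphismProperty.comp_mem injAcyclicCof.rlp f g hf hg

theorem injFibrant_of_injFib {f : X ⟶ Y} (hf : injFib f) (hY : injFibrant Y) : injFibrant X := by
  have := injFib_comp hf hY
  rwa [toOne_unique (f ≫ toOne Y) (toOne X)] at this

theorem injFib_of_isPullback {t : A ⟶ X} {l : A ⟶ B} {f : X ⟶ Y} {b : B ⟶ Y}
    (h : IsPullback t l f b) (hf : injFib f) : injFib l :=
  MorphismProperty.of_isPullback (P := injAcyclicCof.rlp) h hf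

theorem injFibrant_one : injFibrant one.{u} := by
  have := MorphismProperty.id_mem injAcyclicCof.rlp one.{u}
  rwa [toOne_unique (𝟙 _) (toOne one)] at this

/-! ### Path groupoids -/

section Path

variable (f : A ⟶ C)

theorem δ₁_src : δ₁ f ≫ src f = 𝟙 A := rfl

theorem δ₁_tgt : δ₁ f ≫ tgt f = 𝟙 A := rfl

theorem src_comp : src f ≫ f = tgt f ≫ f :=
  hom_ext <| CategoryTheory.Functor.ext (fun P : PathPt f => P.vertical.1) fun P Q s => by
    have h := congrArg f.functor.map (PathHom.comm s)
    obtain ⟨hP, hφ⟩ := P.vertical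
    obtain ⟨hQ, hψ⟩ := Q.vertical
    simp only [Functor.map_comp, hφ, hψ] at h
    have h' := congrArg (· ≫ eqToHom hQ.symm) h
    simp only [Category.assoc, eqToHom_trans, eqToHom_refl, Category.comp_id] at h'
    exact h'

theorem pathPt_ext {f : A ⟶ C} {P Q : PathPt f} (hx : P.x = Q.x) (hy : P.y = Q.y)
    (hφ : HEq P.φ Q.φ) : P = Q := by
  obtain ⟨x, y, φ, h⟩ := P
  obtain ⟨x', y', φ', h'⟩ := Q
  cases hx
  cases hy
  cases hφ
  rfl

theorem pathFunctor_ext {f : A ⟶ C} {D : Type*} [Category D] {F G : D ⥤ PathPt f}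
    (h₁ : F ⋙ (src f).functor = G ⋙ (src f).functor)
    (h₂ : F ⋙ (tgt f).functor = G ⋙ (tgt f).functor)
    (hφ : ∀ d, HEq (F.obj d).φ (G.obj d).φ) : F = G :=
  have h (d : D) : F.obj d = G.obj d :=
    pathPt_ext (Functor.congr_obj h₁ d) (Functor.congr_obj h₂ d) (hφ d)
  Functor.hext h fun _ _ k => pathHom_heq f _ _ (h _) (h _) (Functor.hcongr_hom h₁ k)
    (Functor.hcongr_hom h₂ k)

/-- A square between constant paths has equal sides, and `(1, φ)` is an isomorphism from the
constant path at the source of `φ` to `φ`. -/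
theorem δ₁_injAcyclicCof : injAcyclicCof (δ₁ f) := by
  refine ⟨?_, fun x y h => congrArg PathPt.x h⟩
  have : (δ₁ f).functor.Faithful := ⟨fun h => congrArg PathHom.ρ h⟩
  have : (δ₁ f).functor.Full := ⟨fun {x y} s => ⟨PathHom.ρ s, PathHom.ext rfl (by
    have h := PathHom.comm s
    exact ((Category.comp_id _).symm.trans h).trans (Category.id_comp _))⟩⟩
  have : (δ₁ f).functor.EssSurj := ⟨fun P => ⟨PathPt.x P, ⟨(Groupoid.isoEquivHom _ _).symm
    (⟨𝟙 _, PathPt.φ P, rfl⟩ : PathHom f ((δ₁Functor f).obj (PathPt.x P)) P)⟩⟩⟩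
  exact { }

theorem eq_comp_eqToHom {D : Type*} [Category D] {x y : D} (a : x ⟶ y) (h : y = y) :
    a = a ≫ eqToHom h := by simp

/-- `δ₂ : P_C A ⟶ A ×_C A`. -/
def δ₂ : path f ⟶ pb f f := pbLift (src f) (tgt f) (src_comp f)

/-- Moving the endpoints of `φ` along `(m, n)` forces the new path to be `m⁻¹ ≫ φ ≫ n`. -/
theorem δ₂_isDiscreteFibration : IsDiscreteFibration (δ₂ f).functor where
  exists_lift P {Q} g := by
    obtain ⟨x, y, φ, h, hφ⟩ := P
    obtain ⟨x', y', hw⟩ := Q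
    obtain ⟨m, n, w⟩ := g
    change x ⟶ x' at m
    change y ⟶ y' at n
    change f.functor.map m ≫ eqToHom hw = eqToHom h ≫ f.functor.map n at w
    refine ⟨(⟨x', y', CategoryTheory.inv m ≫ φ ≫ n, hw, ?_⟩ : PathPt f),
      (⟨m, n, IsIso.hom_inv_id_assoc m _⟩ : PathHom f _ _), rfl,
      eq_comp_eqToHom _ _⟩
    rw [f.functor.map_comp, f.functor.map_comp, hφ, Functor.map_inv, IsIso.inv_comp_eq]
    exact w.symm
  unique {P Q} γ h hγ := by
    obtain ⟨x, y, φ, hP⟩ := P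
    obtain ⟨x', y', φ', hQ⟩ := Q
    have hx : x = x' := congrArg PbPt.x h
    have hy : y = y' := congrArg PbPt.y h
    subst hx hy
    have hm : PathHom.ρ γ = 𝟙 x := congrArg PbHom.m hγ
    have hn : PathHom.τ γ = 𝟙 y := congrArg PbHom.n hγ
    have hc := PathHom.comm γ
    rw [hm, hn] at hc
    have hc' : φ' = φ := ((Category.id_comp _).symm.trans hc).trans (Category.comp_id _)
    subst hc'
    exact ⟨rfl, PathHom.ext hm hn⟩

/-- For a discrete fibration all paths are constant. -/
theorem isIso_δ₁ (hf : IsDiscreteFibration f.functor) : IsIso (δ₁ f) := by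
  refine ⟨src f, δ₁_src f, ?_⟩
  have hobj (P : PathPt f) : (δ₁Functor f).obj P.x = P := by
    obtain ⟨x, y, φ, h, hφ⟩ := P
    obtain ⟨rfl, rfl⟩ := hf.unique φ h hφ
    rfl
  have htgt : src f = tgt f := by
    refine hom_ext (hf.functor_eq_of_obj (congrArg Hom.functor (src_comp f)) fun P => ?_)
    rw [← hobj P]
    rfl
  refine hom_ext (pathFunctor_ext rfl (congrArg Hom.functor htgt) fun P => ?_)
  change HEq (PathPt.φ ((δ₁Functor f).obj (PathPt.x P))) (PathPt.φ P)
  rw [hobj P]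

/-- A tower of fibrations: `δ₂` down to `A ×_C A`, a projection to `A`, then `A` to the point. -/
theorem injFibrant_path {f : A ⟶ C} (hf : injFib f) (hA : injFibrant A) : injFibrant (path f) :=
  injFibrant_of_injFib (δ₂_isDiscreteFibration f).injFib
    (injFibrant_of_injFib (injFib_of_isPullback (isPullback_pb f f) hf) hA)

/-- Here `δ₁` lifts against every projective fibration only because it is invertible, which is where
discreteness of `f` enters. -/
theorem isPathObject_proj (hf : IsDiscreteFibration f.functor) :
    IsPathObject projFib f (δ₁ f) (src f) (tgt f) where
  r_d₀ := rfl
  r_d₁ := rfl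
  comm := src_comp f
  acyclicCofibration := by
    have := isIso_δ₁ f hf
    exact MorphismProperty.llp_of_isIso _ _
  fibration := ⟨pb f f, fst f f, snd f f, isPullback_pb f f, by
    have : (isPullback_pb f f).lift (src f) (tgt f) (src_comp f) = δ₂ f :=
      (isPullback_pb f f).hom_ext ((isPullback_pb f f).lift_fst _ _ _)
        ((isPullback_pb f f).lift_snd _ _ _)
    rw [this]
    exact (δ₂_isDiscreteFibration f).projFib⟩

theorem fib_llp {A B : FibObj.{u}} {i : A ⟶ B} (h : injAcyclicCof i.hom) : fib.llp i :=
  llp_inverseImage_ι (MorphismProperty.le_llp_rlp _ _ h)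

theorem isPathObject_fib {A C : FibObj.{u}} (f : A ⟶ C) (hf : fib f)
    (hP : injFibrant (path f.hom)) :
    IsPathObject fib f (fibHom A.property hP (δ₁ f.hom)) (fibHom hP A.property (src f.hom))
      (fibHom hP A.property (tgt f.hom)) where
  r_d₀ := rfl
  r_d₁ := rfl
  comm := ObjectProperty.hom_ext _ (src_comp f.hom)
  acyclicCofibration := fib_llp (δ₁_injAcyclicCof f.hom)
  fibration := by
    have hpb : injFibrant (pb f.hom f.hom) :=
      injFibrant_of_injFib (injFib_of_isPullback (isPullback_pb f.hom f.hom) hf) A.property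
    have h : IsPullback (fibHom hpb A.property (fst f.hom f.hom))
      (fibHom hpb A.property (snd f.hom f.hom)) f f := isPullback_of_ι (isPullback_pb _ _)
    refine ⟨⟨_, hpb⟩, _, _, h, ?_⟩
    have : h.lift (fibHom hP A.property (src f.hom)) (fibHom hP A.property (tgt f.hom))
        (ObjectProperty.hom_ext _ (src_comp f.hom)) = fibHom hP hpb (δ₂ f.hom) :=
      h.hom_ext (h.lift_fst _ _ _) (h.lift_snd _ _ _)
    rw [this]
    exact (δ₂_isDiscreteFibration f.hom).injFib

def isTerminalFibOne : IsTerminal (⟨one.{u}, injFibrant_one⟩ : FibObj.{u}) :=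
  IsTerminal.ofUniqueHom (fun X => ObjectProperty.homMk (toOne X.obj)) fun _ _ =>
    ObjectProperty.hom_ext _ (toOne_unique _ _)

theorem isTerminalFibOne_from_fib (X : FibObj.{u}) : fib (isTerminalFibOne.from X) :=
  X.property

theorem isRightHomotopyEquiv_of_fib_llp {X Y : FibObj.{u}} {f : X ⟶ Y} (hf : fib.llp f) :
    IsRightHomotopyEquiv fib f :=
  isRightHomotopyEquiv_of_llp isTerminalFibOne hf (isTerminalFibOne_from_fib X)
    (isPathObject_fib _ (isTerminalFibOne_from_fib X) (injFibrant_path X.property X.property))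
    (isPathObject_fib _ (isTerminalFibOne_from_fib Y) (injFibrant_path Y.property Y.property))

end Path

end InvGpd
end TTFib

namespace TTFib

namespace InvGpd

/-! ### Extension up to coherent equivariance -/

section Extension

variable {A B Y : InvGpd.{u}}

/-- Along an acyclic cofibration every equivariant functor extends to a functor that is coherently
equivariant up to isomorphism. -/
theorem exists_pseudoEquivariant_extension {i : A ⟶ B} (hi : injAcyclicCof i) (F : A ⟶ Y) :
    ∃ (G : B.carrier ⥤ Y.carrier) (M : G ⋙ Y.inv ⟶ B.inv ⋙ G)
      (hG : i.functor ⋙ G = F.functor),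
      (∀ b, Y.inv.map (M.app b) ≫ M.app (B.inv.obj b) =
        eqToHom ((inv_inv_obj (G.obj b)).trans (congrArg G.obj (inv_inv_obj b).symm))) ∧
      ∀ a, M.app (i.functor.obj a) = eqToHom (by
        have h₁ := Functor.congr_obj hG a
        have h₂ := Functor.congr_obj hG (A.inv.obj a)
        simp only [Functor.comp_obj] at h₁ h₂ ⊢
        rw [h₁, ← obj_inv, ← obj_inv, h₂]) := by
  obtain ⟨_, hinj⟩ := hi
  obtain ⟨R, ε, hR, hε⟩ := exists_retraction i.functor hinj
  -- `K` measures the failure of `R` to commute with the involutions. Its naturality and coherence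
  -- are checked after applying the faithful functor `i`.
  let K (b : B.carrier) : A.inv.obj (R.obj b) ⟶ R.obj (B.inv.obj b) :=
    i.functor.preimage (eqToHom (obj_inv i (R.obj b)) ≫ B.inv.map (ε.app b) ≫
      CategoryTheory.inv (ε.app (B.inv.obj b)))
  have hK (b : B.carrier) : i.functor.map (K b) = eqToHom (obj_inv i (R.obj b)) ≫
      B.inv.map (ε.app b) ≫ CategoryTheory.inv (ε.app (B.inv.obj b)) := i.functor.map_preimage _
  have hε' {b b' : B.carrier} (β : b ⟶ b') : i.functor.map (R.map β) =
      ε.app b ≫ β ≫ CategoryTheory.inv (ε.app b') := by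
    have := ε.naturality β
    simp only [Functor.comp_map, Functor.id_map] at this
    rw [← reassoc_of% this]
    simp
  have hKnat {b b' : B.carrier} (β : b ⟶ b') :
      A.inv.map (R.map β) ≫ K b' = K b ≫ R.map (B.inv.map β) := by
    apply i.functor.map_injective
    simp [hK, map_inv, hε']
  have hKinv (b : B.carrier) : A.inv.map (K b) ≫ K (B.inv.obj b) =
      eqToHom ((inv_inv_obj (R.obj b)).trans (congrArg R.obj (inv_inv_obj b).symm)) := by
    have hεσ : ε.app (B.inv.obj (B.inv.obj b)) =
        eqToHom (by simp [inv_inv_obj]) ≫ ε.app b ≫ eqToHom (inv_inv_obj b).symm := by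
      have := ε.naturality (eqToHom (inv_inv_obj b))
      simp only [Functor.comp_map, Functor.id_map, eqToHom_map] at this
      rw [reassoc_of% this]
      simp
    apply i.functor.map_injective
    simp [hK, map_inv, map_inv_inv, hεσ, eqToHom_map]
  have hKi (a : A.carrier) : K (i.functor.obj a) = eqToHom (by
      have h₁ := Functor.congr_obj hR a
      have h₂ := Functor.congr_obj hR (A.inv.obj a)
      simp only [Functor.comp_obj, Functor.id_obj] at h₁ h₂
      rw [h₁, ← obj_inv, h₂]) := by
    have h : ε.app (B.inv.obj (i.functor.obj a)) = eqToHom (by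
        have h₂ := Functor.congr_obj hR (A.inv.obj a)
        simp only [Functor.comp_obj, Functor.id_obj] at h₂ ⊢
        rw [← obj_inv, h₂]) := by
      have := ε.naturality (eqToHom (obj_inv i a))
      simp only [Functor.comp_map, Functor.id_map, eqToHom_map, hε] at this
      rw [eqToHom_comp_iff] at this
      simp [this]
    apply i.functor.map_injective
    simp [hK, hε, h, eqToHom_map]
  -- `F` is strictly equivariant, so up to equality of objects `M` is `F` applied to `K`.
  let M : (R ⋙ F.functor) ⋙ Y.inv ⟶ B.inv ⋙ (R ⋙ F.functor) :=
    { app := fun b => eqToHom (obj_inv F _).symm ≫ F.functor.map (K b)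
      naturality := fun b b' β => by
        have h := congrArg F.functor.map (hKnat β)
        simp only [Functor.map_comp, map_inv] at h
        simp only [Functor.comp_map, Category.assoc, ← h]
        simp }
  refine ⟨R ⋙ F.functor, M, by rw [← Functor.assoc, hR, Functor.id_comp], fun b => ?_, fun a => ?_⟩
  · have h := congrArg F.functor.map (hKinv b)
    simp only [Functor.map_comp, map_inv, eqToHom_map] at h
    simp only [Category.assoc] at h
    rw [eqToHom_comp_iff] at h
    simp [M, eqToHom_map, h]
  · simp [M, hKi, eqToHom_map]

end Extension

/-! ### Discreteness of `p` and fibrancy of `U` -/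

section Universe

variable {κ : Cardinal.{w}}

/-- The commuting square recovers `τ` from `ρ`, since `X.φ` is surjective. -/
theorem uHom_ext {X Y : UPt.{w} κ} {s t : X ⟶ Y} (h : UHom.ρ s = UHom.ρ t) : s = t :=
  UHom.ext h (Equiv.ext fun y => by
    obtain ⟨x, rfl⟩ := X.φ.surjective y
    rw [← UHom.comm s, ← UHom.comm t, h])

theorem vHom_ext {X Y : VPt.{w} κ} {s t : X ⟶ Y} (h : VHom.toUHom s = VHom.toUHom t) : s = t :=
  VHom.ext (congrArg UHom.ρ h) (congrArg UHom.τ h)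

theorem uHom_heq {X X' Y Y' : UPt.{w} κ} {s : X ⟶ Y} {s' : X' ⟶ Y'} (hX : X = X') (hY : Y = Y')
    (h : HEq (UHom.ρ s) (UHom.ρ s')) : HEq s s' := by
  subst hX hY
  exact heq_of_eq (uHom_ext (eq_of_heq h))

theorem ρ_heq {X X' Y Y' : UPt.{w} κ} {s : X ⟶ Y} {s' : X' ⟶ Y'} (hX : X = X') (hY : Y = Y')
    (h : HEq s s') : HEq (UHom.ρ s) (UHom.ρ s') := by
  subst hX hY h
  rfl

variable (κ) in
-- A lift of `g` must send the base point `a` to `ρ a`, and that choice works.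
theorem p_isDiscreteFibration : IsDiscreteFibration (p κ).functor where
  exists_lift X {Y} g := ⟨(⟨Y, UHom.ρ g (VPt.a X)⟩ : VPt κ),
    (⟨g, rfl⟩ : VHom X ⟨Y, UHom.ρ g (VPt.a X)⟩), rfl,
    eq_comp_eqToHom _ _⟩
  unique {X X'} γ h hγ := by
    obtain ⟨X, x⟩ := X
    obtain ⟨X', x'⟩ := X'
    have hX : X = X' := h
    subst hX
    have hγ' : VHom.toUHom γ = UHom.id X := hγ
    have ha := VHom.map_a γ
    rw [hγ'] at ha
    have ha' : x = x' := ha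
    subst ha'
    exact ⟨rfl, vHom_ext hγ'⟩

/-- The bijection `X.A ≃ Y.A` that corresponds to an isomorphism from the conjugate of `X`. -/
def twist {X Y : UPt.{w} κ} (m : uInv.obj X ⟶ Y) : X.A ≃ Y.A := X.φ.trans (UHom.ρ m)

/-- The point of `U` given by two points and an isomorphism from the conjugate of the first to the
second. -/
def twistPt {X Y : UPt.{w} κ} (m : uInv.obj X ⟶ Y) : UPt.{w} κ := ⟨X.A, Y.A, X.hA, Y.hA, twist m⟩

theorem twist_comp {X X' Y Y' : UPt.{w} κ} {m : uInv.obj X ⟶ Y} {m' : uInv.obj X' ⟶ Y'}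
    {n : X ⟶ X'} {k : Y ⟶ Y'} (h : uInv.map n ≫ m' = m ≫ k) (x : X.A) :
    twist m' (UHom.ρ n x) = UHom.ρ k (twist m x) := by
  have := Equiv.congr_fun (congrArg UHom.ρ h) (X.φ x)
  change UHom.ρ m' (X'.φ (UHom.ρ n x)) = _
  rw [UHom.comm n]
  exact this

/-- The coherence `h` makes `twist m'` the inverse of `twist m`. This turns equivariance up to
isomorphism into strict equivariance. -/
theorem uInv_obj_twistPt {X Y Z : UPt.{w} κ} {m : uInv.obj X ⟶ Y} {m' : uInv.obj Y ⟶ Z}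
    (e : X = Z) (h : uInv.map m ≫ m' = eqToHom e) : twistPt m' = uInv.obj (twistPt m) := by
  subst e
  have key (x : X.A) : twist m' (twist m x) = x := by
    change UHom.ρ m' (Y.φ (UHom.ρ m (X.φ x))) = x
    rw [show Y.φ (UHom.ρ m (X.φ x)) = UHom.τ m (X.φ.symm (X.φ x)) from UHom.comm m (X.φ x)]
    rw [Equiv.symm_apply_apply]
    exact Equiv.congr_fun (congrArg UHom.ρ h) x
  have : twist m' = (twist m).symm := by
    ext y
    obtain ⟨x, rfl⟩ := (twist m).surjective y
    rw [key, Equiv.symm_apply_apply]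
  unfold twistPt
  rw [this]
  rfl

theorem twistPt_eqToHom {X Y X₀ : UPt.{w} κ} (hX : X = X₀) (hY : Y = uInv.obj X₀)
    (h : uInv.obj X = Y) : twistPt (eqToHom h) = X₀ := by
  subst hX hY
  rfl

variable (κ) in
-- Rectification: a coherent extension `(G, M)` is replaced by a strictly equivariant one, with `M`
-- moved into the isomorphism component of the values.
theorem injFibrant_U : injFibrant (U κ) := by
  intro A B i hi
  refine ⟨fun {F v} sq => ?_⟩
  obtain ⟨G, M, hG, hM, hMi⟩ := exists_pseudoEquivariant_extension hi F
  -- The two sets of `G' b` are the first components of `G b` and `G (inv b)`, so the involution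
  -- just swaps them. Over `A`, where `M` is an identity, this returns `F`.
  let G' : B.carrier ⥤ UPt κ :=
    { obj := fun b => twistPt (M.app b)
      map := fun {b b'} β => (⟨UHom.ρ (X := G.obj b) (Y := G.obj b') (G.map β),
        UHom.ρ (X := G.obj (B.inv.obj b)) (Y := G.obj (B.inv.obj b')) (G.map (B.inv.map β)),
        twist_comp (M.naturality β)⟩ : UHom (twistPt (M.app b)) (twistPt (M.app b')))
      map_id := fun b => uHom_ext (by
        have h := congrArg (UHom.ρ (X := G.obj b) (Y := G.obj b)) (G.map_id b)
        exact h)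
      map_comp := fun {b b' b''} β γ => uHom_ext (by
        have h := congrArg (UHom.ρ (X := G.obj b) (Y := G.obj b'')) (G.map_comp β γ)
        exact h) }
  have hobj (b : B.carrier) : G'.obj (B.inv.obj b) = uInv.obj (G'.obj b) :=
    uInv_obj_twistPt (congrArg G.obj (inv_inv_obj b).symm) (hM b)
  have hi₁ (a : A.carrier) : G.obj (i.functor.obj a) = F.functor.obj a :=
    Functor.congr_obj hG a
  have hi₂ (a : A.carrier) : G.obj (B.inv.obj (i.functor.obj a)) = uInv.obj (F.functor.obj a) := by
    rw [← obj_inv, ← Functor.comp_obj, hG]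
    exact obj_inv F a
  have hobji (a : A.carrier) : G'.obj (i.functor.obj a) = F.functor.obj a := by
    change twistPt (M.app (i.functor.obj a)) = _
    rw [hMi]
    exact twistPt_eqToHom (hi₁ a) (hi₂ a) _
  have hcomm : B.inv ⋙ G' = G' ⋙ uInv := Functor.hext hobj fun b b' β =>
    uHom_heq (hobj b) (hobj b') (by
      change HEq (UHom.ρ (X := G.obj (B.inv.obj b)) (Y := G.obj (B.inv.obj b')) _)
        (UHom.ρ (X := G.obj (B.inv.obj b)) (Y := G.obj (B.inv.obj b')) _)
      rfl)
  have hfac : i.functor ⋙ G' = F.functor := Functor.hext hobji fun a a' α =>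
    uHom_heq (hobji a) (hobji a') (by
      change HEq (UHom.ρ (X := G.obj (i.functor.obj a)) (Y := G.obj (i.functor.obj a'))
        (G.map (i.functor.map α))) _
      exact ρ_heq (hi₁ a) (hi₁ a') (Functor.hcongr_hom hG α))
  exact ⟨⟨⟨⟨G', hcomm⟩, hom_ext hfac, toOne_unique _ _⟩⟩⟩

end Universe

end InvGpd
end TTFib

/-! ### Isomorphisms between pullbacks of `p`: transport and action on fibres -/

namespace TTFib

/-- A generic isomorphism may be tested against a choice of pullbacks. -/
theorem IsGenericIso.of_choice {C : Type u} [Category.{v} C] {V U E : C} {p : V ⟶ U}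
    {e₀ e₁ : E ⟶ U} {S₁ : PullbackOf p e₀} {S₂ : PullbackOf p e₁} {φ : S₁.X ≅ S₂.X}
    (S : ∀ {T : C} (a : T ⟶ U), PullbackOf p a)
    (h : ∀ {T : C} {a b : T ⟶ U} (ψ : (S a).X ≅ (S b).X), ψ.hom ≫ (S b).left = (S a).left →
      ∃! t : T ⟶ E, t ≫ e₀ = a ∧ t ≫ e₁ = b ∧ ∃ c : (S a).X ⟶ S₁.X, c ≫ S₁.top = (S a).top ∧
        c ≫ S₁.left = (S a).left ≫ t ∧ ψ.hom ≫ (S b).top = c ≫ φ.hom ≫ S₂.top) :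
    IsGenericIso S₁ S₂ φ := by
  intro T a b S₁' S₂' ψ hψ
  let j₁ := S₁'.isPullback.isoIsPullback _ _ (S a).isPullback
  let j₂ := S₂'.isPullback.isoIsPullback _ _ (S b).isPullback
  have h₁ : j₁.hom ≫ (S a).top = S₁'.top := IsPullback.isoIsPullback_hom_fst ..
  have h₁' : j₁.hom ≫ (S a).left = S₁'.left := IsPullback.isoIsPullback_hom_snd ..
  have h₂ : j₂.hom ≫ (S b).top = S₂'.top := IsPullback.isoIsPullback_hom_fst ..
  have h₂' : j₂.hom ≫ (S b).left = S₂'.left := IsPullback.isoIsPullback_hom_snd ..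
  obtain ⟨t, ⟨ha, hb, c, hc, hc', hct⟩, ht⟩ := h (j₁.symm ≪≫ ψ ≪≫ j₂)
    (by simp [h₂', hψ, ← h₁'])
  refine ⟨t, ⟨ha, hb, j₁.hom ≫ c, by simp [hc, h₁], by simp [hc', reassoc_of% h₁'], ?_⟩, ?_⟩
  · rw [Category.assoc, ← hct]
    simp [h₂]
  · rintro s ⟨ha, hb, d, hd, hd', hds⟩
    exact ht s ⟨ha, hb, j₁.inv ≫ d, by simp [hd, ← h₁], by simp [hd', ← h₁'], by
      simp [h₂, hds]⟩

namespace InvGpd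

variable {κ : Cardinal.{w}} {T : InvGpd.{w + 1}}

theorem ρ_comp {X Y Z : UPt.{w} κ} (s : X ⟶ Y) (t : Y ⟶ Z) (x : X.A) :
    UHom.ρ (s ≫ t) x = UHom.ρ t (UHom.ρ s x) := rfl

/-- The pointwise content of equivariance of `transport`. The conjugates `X'`, `Y'` are kept as
variables so that the equalities can be substituted. -/
theorem vPt_mk_inv {X Y X' Y' : UPt.{w} κ} (α : X ⟶ Y) (β : X' ⟶ Y') (hX : uInv.obj X = X')
    (hY : uInv.obj Y = Y') (h : eqToHom hX ≫ β = uInv.map α ≫ eqToHom hY) (x : X.A) :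
    VPt.mk Y' (UHom.ρ (eqToHom hX ≫ β) (X.φ x)) = VPt.mk (uInv.obj Y) (Y.φ (UHom.ρ α x)) := by
  subst hX hY
  rw [eqToHom_refl, eqToHom_refl, Category.comp_id] at h
  rw [eqToHom_refl, h, UHom.comm α]
  rfl

/-- The underlying functor of a map into `U`. -/
def toUPt (a : T ⟶ U κ) : T.carrier ⥤ UPt κ := a.functor

theorem toUPt_inv (a : T ⟶ U κ) (t : T.carrier) :
    uInv.obj ((toUPt a).obj t) = (toUPt a).obj (T.inv.obj t) := (obj_inv a t).symm

section Transport

variable {a b : T ⟶ U κ}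

/-- The first component of a point of the pullback of `p` along `a`. -/
def pbVPt (P : PbPt (p κ) a) : VPt κ := P.x

def pbVHom {P Q : PbPt (p κ) a} (k : P ⟶ Q) : pbVPt P ⟶ pbVPt Q := PbHom.m k

theorem pbVPt_w (P : PbPt (p κ) a) : (pbVPt P).toUPt = (toUPt a).obj P.y := P.w

theorem pbVHom_w {P Q : PbPt (p κ) a} (k : P ⟶ Q) :
    CategoryStruct.comp (X := (pbVPt P).toUPt) (Y := (pbVPt Q).toUPt) (VHom.toUHom (pbVHom k))
      (eqToHom (pbVPt_w Q)) =
      eqToHom (pbVPt_w P) ≫ (toUPt a).map (PbHom.n k) := PbHom.w k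

variable (α : toUPt a ⟶ toUPt b)

/-- The underlying functor of `transport`. -/
def transportFunctor : PbPt (p κ) a ⥤ VPt κ where
  obj P := ⟨(toUPt b).obj P.y, UHom.ρ (eqToHom (pbVPt_w P) ≫ α.app P.y) (pbVPt P).a⟩
  map {P Q} k :=
    { toUHom := (toUPt b).map (PbHom.n k)
      map_a := by
        have h := congrArg (· ≫ α.app Q.y) (pbVHom_w k)
        simp only [Category.assoc, α.naturality] at h
        have h' := Equiv.congr_fun (congrArg UHom.ρ h) (pbVPt P).a
        rw [ρ_comp, VHom.map_a (pbVHom k)] at h'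
        exact h'.symm }
  map_id P := vHom_ext ((toUPt b).map_id _)
  map_comp s t := vHom_ext ((toUPt b).map_comp _ _)

/-- The map from the pullback of `p` along `a` to `Ũ` over `b` induced by an equivariant natural
transformation from `a` to `b`. -/
def transport (hα : ∀ t, eqToHom (toUPt_inv a t) ≫ α.app (T.inv.obj t) =
    uInv.map (α.app t) ≫ eqToHom (toUPt_inv b t)) : pb (p κ) a ⟶ UTilde κ where
  functor := transportFunctor α
  comm := by
    refine (p_isDiscreteFibration κ).functor_eq_of_obj
      (congrArg (pbSnd (p κ) a ⋙ ·) b.comm) ?_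
    rintro ⟨⟨X, x⟩, t, h⟩
    change X = (toUPt a).obj t at h
    subst h
    exact vPt_mk_inv (𝟙 _ ≫ α.app t) (α.app (T.inv.obj t)) (toUPt_inv a t) (toUPt_inv b t)
      (by rw [Category.id_comp, hα]) x

theorem transport_p (hα : ∀ t, eqToHom (toUPt_inv a t) ≫ α.app (T.inv.obj t) =
    uInv.map (α.app t) ≫ eqToHom (toUPt_inv b t)) :
    transport α hα ≫ p κ = snd (p κ) a ≫ b := rfl

end Transport

/-! ### Fibres -/

/-- A point of the pullback of `p` along `a`. -/
def pbMk (a : T ⟶ U κ) (t : T.carrier) (X : UPt κ) (hX : X = (toUPt a).obj t) (x : X.A) :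
    PbPt (p κ) a := ⟨⟨X, x⟩, t, hX⟩

theorem pbMk_injective {a : T ⟶ U κ} {t : T.carrier} {X : UPt κ} {hX : X = (toUPt a).obj t} :
    Function.Injective (pbMk a t X hX) := fun x y h => by
  have := congrArg (fun P => pbVPt P) h
  simpa [pbMk, pbVPt] using this

variable {a b : T ⟶ U κ}

theorem exists_pbMk_eq (t : T.carrier) (Y : UPt κ) (hY : Y = (toUPt b).obj t) (P : PbPt (p κ) b)
    (hP : P.y = t) : ∃ y, P = pbMk b t Y hY y := by
  obtain ⟨⟨X, x⟩, s, h⟩ := P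
  change X = (toUPt b).obj s at h
  change s = t at hP
  subst hP hY h
  exact ⟨x, rfl⟩

section FiberMap

variable (f : pb (p κ) a ⟶ pb (p κ) b) (hf : f ≫ snd (p κ) b = snd (p κ) a) (t : T.carrier)
  (X : UPt κ) (hX : X = (toUPt a).obj t) (Y : UPt κ) (hY : Y = (toUPt b).obj t)

/-- The action of a map over `T` on fibres. -/
noncomputable def fiberMap (x : X.A) : Y.A :=
  (exists_pbMk_eq t Y hY (f.functor.obj (pbMk a t X hX x))
    (Functor.congr_obj (congrArg Hom.functor hf) (pbMk a t X hX x))).choose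

theorem fiberMap_spec (x : X.A) : f.functor.obj (pbMk a t X hX x) =
    pbMk b t Y hY (fiberMap f hf t X hX Y hY x) :=
  (exists_pbMk_eq t Y hY (f.functor.obj (pbMk a t X hX x))
    (Functor.congr_obj (congrArg Hom.functor hf) (pbMk a t X hX x))).choose_spec

theorem fiberMap_unique {x : X.A} {y : Y.A}
    (h : f.functor.obj (pbMk a t X hX x) = pbMk b t Y hY y) :
    fiberMap f hf t X hX Y hY x = y :=
  pbMk_injective ((fiberMap_spec f hf t X hX Y hY x).symm.trans h)

end FiberMap

section FiberEquiv

variable (ψ : pb (p κ) a ≅ pb (p κ) b) (hψ : ψ.hom ≫ snd (p κ) b = snd (p κ) a)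

include hψ in
theorem iso_inv_snd : ψ.inv ≫ snd (p κ) a = snd (p κ) b := by
  rw [← hψ, ψ.inv_hom_id_assoc]

/-- The bijections on fibres given by an isomorphism over `T`. -/
noncomputable def fiberEquiv (t : T.carrier) (X : UPt κ) (hX : X = (toUPt a).obj t) (Y : UPt κ)
    (hY : Y = (toUPt b).obj t) : X.A ≃ Y.A where
  toFun := fiberMap ψ.hom hψ t X hX Y hY
  invFun := fiberMap ψ.inv (iso_inv_snd ψ hψ) t Y hY X hX
  left_inv x := fiberMap_unique _ _ _ _ _ _ _ (by
    rw [← fiberMap_spec]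
    exact Functor.congr_obj (congrArg Hom.functor ψ.hom_inv_id) _)
  right_inv x := fiberMap_unique _ _ _ _ _ _ _ (by
    rw [← fiberMap_spec]
    exact Functor.congr_obj (congrArg Hom.functor ψ.inv_hom_id) _)

theorem fiberEquiv_spec (t : T.carrier) (X : UPt κ) (hX : X = (toUPt a).obj t) (Y : UPt κ)
    (hY : Y = (toUPt b).obj t) (x : X.A) : ψ.hom.functor.obj (pbMk a t X hX x) =
      pbMk b t Y hY (fiberEquiv ψ hψ t X hX Y hY x) :=
  fiberMap_spec _ hψ ..

theorem fiberEquiv_heq (t : T.carrier) {X X' : UPt κ} (hX : X = (toUPt a).obj t)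
    (hX' : X' = (toUPt a).obj t) {Y Y' : UPt κ} (hY : Y = (toUPt b).obj t)
    (hY' : Y' = (toUPt b).obj t) :
    HEq (fiberEquiv ψ hψ t X hX Y hY) (fiberEquiv ψ hψ t X' hX' Y' hY') := by
  subst hX hX' hY hY'
  rfl

/-- Equivariance of `ψ`, read on fibres. The fibre over `inv t` is named through `uInv`, which is
why `fiberEquiv` takes `X` and `Y` with equations instead of the values of `a` and `b`. -/
theorem fiberEquiv_inv (t : T.carrier) (x : ((toUPt a).obj t).A) :
    UPt.φ ((toUPt b).obj t) (fiberEquiv ψ hψ t _ rfl _ rfl x) =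
      fiberEquiv ψ hψ (T.inv.obj t) (uInv.obj ((toUPt a).obj t)) (toUPt_inv a t)
        (uInv.obj ((toUPt b).obj t)) (toUPt_inv b t) (UPt.φ ((toUPt a).obj t) x) := by
  have h := obj_inv ψ.hom (pbMk a t _ rfl x)
  rw [fiberEquiv_spec ψ hψ t _ rfl _ rfl] at h
  exact (pbMk_injective ((fiberEquiv_spec ψ hψ _ _ (toUPt_inv a t) _ (toUPt_inv b t) _).symm.trans
    h)).symm

theorem eq_of_comp_eqToHom_eq {D : Type*} [Category D] {x y : D} {s t : x ⟶ y} {hx : x = x}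
    {hy : y = y} (h : s ≫ eqToHom hy = eqToHom hx ≫ t) : s = t := by
  simpa using h

theorem map_a_of_eq {t t' : T.carrier} {P Q : PbPt (p κ) b} (s : P ⟶ Q) (g : t ⟶ t')
    {y : ((toUPt b).obj t).A} {y' : ((toUPt b).obj t').A} (hP : P = pbMk b t _ rfl y)
    (hQ : Q = pbMk b t' _ rfl y') (hs : HEq (PbHom.n s) g) :
    UHom.ρ ((toUPt b).map g) y = y' := by
  subst hP hQ
  have hs' : PbHom.n s = g := eq_of_heq hs
  subst hs'
  have hw : VHom.toUHom (pbVHom s) = (toUPt b).map (PbHom.n s) :=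
    eq_of_comp_eqToHom_eq (D := UPt κ) (pbVHom_w s)
  have h := VHom.map_a (pbVHom s)
  rw [hw] at h
  exact h

theorem fiberEquiv_naturality {t t' : T.carrier} (g : t ⟶ t') (x : ((toUPt a).obj t).A) :
    fiberEquiv ψ hψ t' _ rfl _ rfl
        (UHom.ρ ((toUPt a).map g) x) =
      UHom.ρ ((toUPt b).map g)
        (fiberEquiv ψ hψ t _ rfl _ rfl x) := by
  -- The lift of `g` starting at `x`; its image under `ψ` still lies over `g`, hence acts by `b g`.
  let m : pbMk a t _ rfl x ⟶ pbMk a t' _ rfl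
      (UHom.ρ ((toUPt a).map g) x) :=
    { m := { toUHom := (toUPt a).map g, map_a := rfl }
      n := g
      w := ((Category.comp_id ((toUPt a).map g)).trans (Category.id_comp _).symm) }
  exact (map_a_of_eq (ψ.hom.functor.map m) g (fiberEquiv_spec ψ hψ t _ rfl _ rfl x)
    (fiberEquiv_spec ψ hψ t' _ rfl _ rfl _)
    (Functor.hcongr_hom (congrArg Hom.functor hψ) m)).symm

end FiberEquiv

end InvGpd
end TTFib

namespace TTFib

namespace InvGpd

variable {κ : Cardinal.{w}} {T : InvGpd.{w + 1}} {a b : T ⟶ U κ}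

theorem eqToHom_comp_eq_comp_eqToHom {D : Type*} [Category D] {x y : D} {s t : x ⟶ y} (h : s = t)
    (hx : x = x) (hy : y = y) : eqToHom hx ≫ s = t ≫ eqToHom hy := by
  simp [h]

/-- The chosen pullback of `p`. -/
def stdPullback (a : T ⟶ U κ) : PullbackOf (p κ) a := ⟨_, _, _, isPullback_pb (p κ) a⟩

section TransportIso

variable (α : toUPt a ≅ toUPt b)
  (hα : ∀ t, eqToHom (toUPt_inv a t) ≫ α.hom.app (T.inv.obj t) =
    uInv.map (α.hom.app t) ≫ eqToHom (toUPt_inv b t))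
  (hα' : ∀ t, eqToHom (toUPt_inv b t) ≫ α.inv.app (T.inv.obj t) =
    uInv.map (α.inv.app t) ≫ eqToHom (toUPt_inv a t))

theorem transport_transport :
    pbLift (transport α.hom hα) (snd (p κ) a) (transport_p _ hα) ≫ transport α.inv hα' =
      fst (p κ) a := by
  refine hom_ext ((p_isDiscreteFibration κ).functor_eq_of_obj pbFst_comp.symm ?_)
  rintro ⟨⟨X, x⟩, t, h⟩
  change X = (toUPt a).obj t at h
  subst h
  have h := Equiv.congr_fun (congrArg UHom.ρ (α.hom_inv_id_app t)) x
  exact congrArg (VPt.mk _) h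

/-- The isomorphism of pullbacks of `p` induced by an equivariant natural isomorphism. -/
def transportIso : (stdPullback a).X ≅ (stdPullback b).X where
  hom := pbLift (transport α.hom hα) (snd (p κ) a) (transport_p _ hα)
  inv := pbLift (transport α.inv hα') (snd (p κ) b) (transport_p _ hα')
  hom_inv_id := pb_hom_ext (transport_transport α hα hα') rfl
  inv_hom_id := pb_hom_ext (transport_transport α.symm hα' hα) rfl

end TransportIso

/-! ### The universal isomorphism -/

variable (κ) in
/-- The tautological isomorphism between the two ends of a path in `U`. -/
def pathIso : toUPt (src (toOne (U κ))) ≅ toUPt (tgt (toOne (U κ))) :=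
  NatIso.ofComponents
    (fun P => (Groupoid.isoEquivHom (C := UPt κ) _ _).symm (PathPt.φ P))
    fun s => PathHom.comm s

variable (κ) in
/-- The generic isomorphism between pullbacks of `p`, over `P_1 U`. -/
def genericIso : (stdPullback (src (toOne (U κ)))).X ≅ (stdPullback (tgt (toOne (U κ)))).X :=
  transportIso (pathIso κ) (fun _ => eqToHom_comp_eq_comp_eqToHom (D := UPt κ) rfl _ _)
    fun _ => eqToHom_comp_eq_comp_eqToHom (D := UPt κ) rfl _ _

variable (κ) in
theorem genericIso_left : (genericIso κ).hom ≫ (stdPullback (tgt (toOne (U κ)))).left =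
    (stdPullback (src (toOne (U κ)))).left := rfl

theorem toOne_vertical {X : InvGpd.{u}} {x y : X.carrier} (φ : x ⟶ y) :
    ∃ h : (toOne X).functor.obj x = (toOne X).functor.obj y,
      (toOne X).functor.map φ = eqToHom h :=
  ⟨rfl, rfl⟩

section Classify

variable (ψ : pb (p κ) a ≅ pb (p κ) b) (hψ : ψ.hom ≫ snd (p κ) b = snd (p κ) a)

/-- The isomorphism of points of `U` given by the action on fibres. -/
noncomputable def fiberHom (t : T.carrier) : (toUPt a).obj t ⟶ (toUPt b).obj t where
  ρ := fiberEquiv ψ hψ t _ rfl _ rfl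
  -- The second set of `a t` is the first set of `a (inv t)`, so `τ` is the action on the fibre over
  -- `inv t`.
  τ := fiberEquiv ψ hψ (T.inv.obj t) (uInv.obj ((toUPt a).obj t)) (toUPt_inv a t)
    (uInv.obj ((toUPt b).obj t)) (toUPt_inv b t)
  comm := fiberEquiv_inv ψ hψ t

noncomputable def classifyFunctor : T.carrier ⥤ PathPt (toOne (U κ)) where
  obj t := ⟨(toUPt a).obj t, (toUPt b).obj t, fiberHom ψ hψ t, toOne_vertical _⟩
  map g :=
    { ρ := (toUPt a).map g
      τ := (toUPt b).map g
      comm := uHom_ext (Equiv.ext fun x => fiberEquiv_naturality ψ hψ g x) }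
  map_id t := PathHom.ext ((toUPt a).map_id t) ((toUPt b).map_id t)
  map_comp g h := PathHom.ext ((toUPt a).map_comp g h) ((toUPt b).map_comp g h)

/-- The map into `P_1 U` that classifies an isomorphism between pullbacks of `p`. -/
noncomputable def classify : T ⟶ path (toOne (U κ)) where
  functor := classifyFunctor ψ hψ
  comm := pathFunctor_ext a.comm b.comm fun t =>
    uHom_heq (toUPt_inv a t).symm (toUPt_inv b t).symm (fiberEquiv_heq ψ hψ _ _ _ _ _)

theorem classify_spec : ψ.hom ≫ fst (p κ) b =
    pbLift (g := src (toOne (U κ))) (fst (p κ) a) (snd (p κ) a ≫ classify ψ hψ)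
      (isPullback_pb (p κ) a).w ≫ (genericIso κ).hom ≫ fst (p κ) _ := by
  refine hom_ext ((p_isDiscreteFibration κ).functor_eq_of_obj ?_ ?_)
  · have h := congrArg Hom.functor ((congrArg (ψ.hom ≫ ·) (isPullback_pb (p κ) b).w).trans
      (congrArg (· ≫ b) hψ))
    exact h
  · rintro ⟨⟨X, x⟩, t, h⟩
    change X = (toUPt a).obj t at h
    subst h
    have h := congrArg pbVPt (fiberEquiv_spec ψ hψ t _ rfl _ rfl x)
    exact h

end Classify

theorem vPt_mk_injective {X : UPt.{w} κ} {x y : X.A} (h : VPt.mk X x = VPt.mk X y) : x = y := by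
  simpa using h

theorem φ_heq {P Q : PathPt (toOne (U κ))} (hx : P.x = Q.x) (hy : P.y = Q.y)
    (h : ∀ (x : UPt.A P.x), VPt.mk P.y (UHom.ρ P.φ x) =
      VPt.mk Q.y (UHom.ρ Q.φ (UHom.ρ (X := P.x) (Y := Q.x) (eqToHom hx) x))) :
    HEq P.φ Q.φ := by
  obtain ⟨X, Y, φ, h₁⟩ := P
  obtain ⟨X', Y', φ', h₂⟩ := Q
  change X = X' at hx
  change Y = Y' at hy
  subst hx hy
  refine heq_of_eq (uHom_ext (Equiv.ext fun x => vPt_mk_injective (h x)))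

/-- The endpoints of `k t` are fixed by `a` and `b`. Evaluating `h` at the points of the fibre over
`t` gives the remaining datum, the bijection `ρ`. -/
theorem path_hom_ext {k k' : T ⟶ path (toOne (U κ))}
    (h₀ : k ≫ src (toOne (U κ)) = a) (h₁ : k ≫ tgt (toOne (U κ)) = b)
    (h₀' : k' ≫ src (toOne (U κ)) = a) (h₁' : k' ≫ tgt (toOne (U κ)) = b)
    {c c' : pb (p κ) a ⟶ pb (p κ) (src (toOne (U κ)))}
    (hc : c ≫ fst _ _ = fst _ _) (hs : c ≫ snd _ _ = snd _ _ ≫ k)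
    (hc' : c' ≫ fst _ _ = fst _ _) (hs' : c' ≫ snd _ _ = snd _ _ ≫ k')
    (h : c ≫ (genericIso κ).hom ≫ fst _ _ = c' ≫ (genericIso κ).hom ≫ fst _ _) : k = k' := by
  subst h₀ h₁
  refine hom_ext (pathFunctor_ext (congrArg Hom.functor h₀'.symm) (congrArg Hom.functor h₁'.symm)
    fun t => ?_)
  have hx : PathPt.x (k.functor.obj t) = PathPt.x (k'.functor.obj t) :=
    Functor.congr_obj (congrArg Hom.functor h₀'.symm) t
  have hy : PathPt.y (k.functor.obj t) = PathPt.y (k'.functor.obj t) :=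
    Functor.congr_obj (congrArg Hom.functor h₁'.symm) t
  refine φ_heq hx hy fun x => ?_
  -- The comparison maps are forced, so `h` can be computed on points.
  have e : c = pbLift (fst (p κ) _) (snd (p κ) _ ≫ k) (isPullback_pb (p κ) _).w :=
    pb_hom_ext hc hs
  have e' : c' = pbLift (fst (p κ) _) (snd (p κ) _ ≫ k')
      (by rw [Category.assoc, h₀', (isPullback_pb (p κ) _).w]) := pb_hom_ext hc' hs'
  subst e e'
  have := Functor.congr_obj (congrArg Hom.functor h) (pbMk _ t _ rfl x)
  refine Eq.trans ?_ this
  rfl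

variable (κ) in
theorem isGenericIso : IsGenericIso (stdPullback (src (toOne (U κ))))
    (stdPullback (tgt (toOne (U κ)))) (genericIso κ) := by
  refine IsGenericIso.of_choice (S₁ := stdPullback (src (toOne (U κ))))
    (S₂ := stdPullback (tgt (toOne (U κ)))) (φ := genericIso κ) stdPullback
    fun {T a b} ψ hψ => ⟨classify ψ hψ, ⟨rfl, rfl,
    pbLift (g := src (toOne (U κ))) (fst (p κ) a) (snd (p κ) a ≫ classify ψ hψ)
      (isPullback_pb (p κ) a).w, rfl, rfl, classify_spec ψ hψ⟩, ?_⟩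
  rintro k ⟨h₀, h₁, c, hc, hs, h⟩
  exact path_hom_ext h₀ h₁ rfl rfl hc hs rfl rfl (h.symm.trans (classify_spec ψ hψ))

/-- The generic isomorphism restricts along `δ₁` to the identity of `Ũ`; this identifies `U ⟶ E`
with `δ₁`. -/
theorem δ₁_generic : pbLift (g := src (toOne (U κ))) (𝟙 (UTilde κ)) (p κ ≫ δ₁ (toOne (U κ))) rfl ≫
    (genericIso κ).hom ≫ fst (p κ) _ = 𝟙 (UTilde κ) :=
  hom_ext ((p_isDiscreteFibration κ).functor_eq_of_obj rfl fun _ => rfl)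

/-! ### The object of equivalences in the injective structure -/

variable (κ) in
theorem injFib_p : injFib (p κ) := (p_isDiscreteFibration κ).injFib

variable (κ) in
theorem injFibrant_UTilde : injFibrant (UTilde κ) :=
  injFibrant_of_injFib (injFib_p κ) (injFibrant_U κ)

theorem injFibrant_stdPullback (a : T ⟶ U κ) (hT : injFibrant T) :
    injFibrant (stdPullback a).X :=
  injFibrant_of_injFib (injFib_of_isPullback (stdPullback a).isPullback (injFib_p κ)) hT

section EquivObject

variable {C : Type u} [Category.{v} C] {V U P : C} {p : V ⟶ U} {d₀ d₁ : P ⟶ V}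

theorem _root_.TTFib.EquivObject.idMap_ofIsGenericIso {r : V ⟶ P} (h₀ : r ≫ d₀ = 𝟙 V)
    (h₁ : r ≫ d₁ = 𝟙 V) [IsIso r] {E : C} {e₀ e₁ : E ⟶ U} {S₁ : PullbackOf p e₀}
    {S₂ : PullbackOf p e₁} {φ : S₁.X ≅ S₂.X} (hφ : φ.hom ≫ S₂.left = S₁.left)
    (huniv : IsGenericIso S₁ S₂ φ) {i : U ⟶ E} (hi₀ : i ≫ e₀ = 𝟙 U) (hi₁ : i ≫ e₁ = 𝟙 U)
    {c : V ⟶ S₁.X} (hc : c ≫ S₁.top = 𝟙 V) (hc' : c ≫ S₁.left = p ≫ i)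
    (h : c ≫ φ.hom ≫ S₂.top = 𝟙 V) :
    (EquivObject.ofIsGenericIso h₀ h₁ hφ huniv).idMap r h₀ h₁ = i := by
  apply EquivObject.idMap_eq
  exact (EquivOver.isRestriction_iff h₀ h₁ _ _ _).2 ⟨hi₀, hi₁, c, hc, hc',
    (Category.id_comp _).trans h.symm⟩

end EquivObject

variable (hU : injFibrant (U κ)) (hV : injFibrant (UTilde κ)) (hPV : injFibrant (path (p κ)))
  (hPU : injFibrant (path (toOne (U κ))))

theorem isIso_fibHom_δ₁ : IsIso (fibHom hV hPV (δ₁ (p κ))) := by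
  have : IsIso (fibHom hV hPV (δ₁ (p κ))).hom := isIso_δ₁ (p κ) (p_isDiscreteFibration κ)
  exact (ObjectProperty.isIso_hom_iff _).1 this

theorem exists_fib_equivObject :
    ∃ 𝓕 : EquivObject (fibHom hV hU (p κ)) (fibHom hPV hV (src (p κ)))
        (fibHom hPV hV (tgt (p κ))),
      ∃ θ : 𝓕.E ≅ ⟨path (toOne (U κ)), hPU⟩,
        θ.hom ≫ fibHom hPU hU (src (toOne (U κ))) = 𝓕.e₀ ∧
        θ.hom ≫ fibHom hPU hU (tgt (toOne (U κ))) = 𝓕.e₁ ∧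
        ∀ (h₀ : fibHom hV hPV (δ₁ (p κ)) ≫ fibHom hPV hV (src (p κ)) = 𝟙 _)
          (h₁ : fibHom hV hPV (δ₁ (p κ)) ≫ fibHom hPV hV (tgt (p κ)) = 𝟙 _),
          𝓕.idMap _ h₀ h₁ ≫ θ.hom = fibHom hU hPU (δ₁ (toOne (U κ))) := by
  have := isIso_fibHom_δ₁ hV hPV
  have h₀ : fibHom hV hPV (δ₁ (p κ)) ≫ fibHom hPV hV (src (p κ)) = 𝟙 _ := rfl
  have h₁ : fibHom hV hPV (δ₁ (p κ)) ≫ fibHom hPV hV (tgt (p κ)) = 𝟙 _ := rfl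
  have hS₁ := injFibrant_stdPullback (src (toOne (U κ))) hPU
  have hS₂ := injFibrant_stdPullback (tgt (toOne (U κ))) hPU
  have hgen := IsGenericIso.lift (p := fibHom hV hU (p κ))
    (e₀ := fibHom hPU hU (src (toOne (U κ)))) (e₁ := fibHom hPU hU (tgt (toOne (U κ))))
    (isGenericIso κ) hS₁ hS₂ fun a hT => ⟨stdPullback a, injFibrant_stdPullback a hT⟩
  refine ⟨EquivObject.ofIsGenericIso h₀ h₁
    (ObjectProperty.hom_ext _ (genericIso_left κ)) hgen, Iso.refl _,
    Category.id_comp _, Category.id_comp _, fun _ _ => (Category.comp_id _).trans ?_⟩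
  refine EquivObject.idMap_ofIsGenericIso h₀ h₁ _ hgen rfl rfl (c := ObjectProperty.homMk
    (pbLift (g := src (toOne (U κ))) (𝟙 (UTilde κ)) (p κ ≫ δ₁ (toOne (U κ))) rfl)) rfl rfl ?_
  exact ObjectProperty.hom_ext _ δ₁_generic

/-- Objects of equivalences are unique up to compatible isomorphism, so everything transfers from
the model `P_1 U`. -/
theorem fib_equivObject_spec (𝓔 : EquivObject (fibHom hV hU (p κ)) (fibHom hPV hV (src (p κ)))
      (fibHom hPV hV (tgt (p κ))))
    (h₀ : fibHom hV hPV (δ₁ (p κ)) ≫ fibHom hPV hV (src (p κ)) = 𝟙 _)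
    (h₁ : fibHom hV hPV (δ₁ (p κ)) ≫ fibHom hPV hV (tgt (p κ)) = 𝟙 _) :
    (∃ θ : 𝓔.E ≅ ⟨path (toOne (U κ)), hPU⟩,
      θ.hom ≫ fibHom hPU hU (src (toOne (U κ))) = 𝓔.e₀ ∧
      θ.hom ≫ fibHom hPU hU (tgt (toOne (U κ))) = 𝓔.e₁ ∧
      𝓔.idMap _ h₀ h₁ ≫ θ.hom = fibHom hU hPU (δ₁ (toOne (U κ)))) ∧
    fib.llp (𝓔.idMap _ h₀ h₁) ∧ IsRightHomotopyEquiv fib (𝓔.idMap _ h₀ h₁) := by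
  obtain ⟨𝓕, η, he₀, he₁, hid⟩ := exists_fib_equivObject hU hV hPV hPU
  obtain ⟨θ, hθ₀, hθ₁, hθ⟩ := 𝓔.exists_iso 𝓕
  have hδ : 𝓔.idMap _ h₀ h₁ ≫ (θ ≪≫ η).hom = fibHom hU hPU (δ₁ (toOne (U κ))) := by
    rw [Iso.trans_hom, reassoc_of% hθ, hid]
  have hllp : fib.llp (𝓔.idMap _ h₀ h₁) := by
    have : 𝓔.idMap _ h₀ h₁ = fibHom hU hPU (δ₁ (toOne (U κ))) ≫ (θ ≪≫ η).inv := by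
      rw [← hδ, Category.assoc, Iso.hom_inv_id, Category.comp_id]
    rw [this]
    exact MorphismProperty.comp_mem _ _ _ (fib_llp (δ₁_injAcyclicCof _))
      (MorphismProperty.llp_of_isIso _ _)
  refine ⟨⟨θ ≪≫ η, ?_, ?_, hδ⟩, hllp, isRightHomotopyEquiv_of_fib_llp hllp⟩
  · rw [Iso.trans_hom, Category.assoc, he₀, hθ₀]
  · rw [Iso.trans_hom, Category.assoc, he₁, hθ₁]

end InvGpd
end TTFib

/-! ### Failure of univalence in the projective structure -/

namespace TTFib

theorem EquivOver.IsRestriction.f_eq {C : Type u} [Category.{v} C] {V U P : C} {p : V ⟶ U}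
    {d₀ d₁ : P ⟶ V} {T T' : C} {a b : T ⟶ U} {a' b' : T' ⟶ U} {S₁ : PullbackOf p a}
    {S₂ : PullbackOf p b} {S₁' : PullbackOf p a'} {S₂' : PullbackOf p b'}
    {e : EquivOver p d₀ d₁ S₁ S₂} {t : T' ⟶ T} {e' e'' : EquivOver p d₀ d₁ S₁' S₂'}
    (h' : e.IsRestriction t e') (h'' : e.IsRestriction t e'') : e'.f = e''.f := by
  obtain ⟨-, -, c₁, c₂, h₁, h₁', h₂, -, hf, -⟩ := h'
  obtain ⟨-, -, k₁, k₂, l₁, l₁', l₂, -, lf, -⟩ := h''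
  have hc : c₁ = k₁ := S₁.isPullback.hom_ext (h₁.trans l₁.symm) (h₁'.trans l₁'.symm)
  apply S₂'.isPullback.hom_ext
  · rw [← h₂, reassoc_of% hf, h₂, ← l₂, reassoc_of% lf, hc]
  · rw [e'.f_left, e''.f_left]

/-- Consequently an equivalence whose classifying map factors through `U ⟶ E` has an identity as its
`f`. -/
theorem EquivOver.isRestriction_refl {C : Type u} [Category.{v} C] {V U P : C} {p : V ⟶ U}
    {r : V ⟶ P} {d₀ d₁ : P ⟶ V} (h₀ : r ≫ d₀ = 𝟙 V) (h₁ : r ≫ d₁ = 𝟙 V) {T : C} {a : T ⟶ U}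
    (S : PullbackOf p a) : (EquivOver.refl p r d₀ d₁ h₀ h₁).IsRestriction a
      (EquivOver.ofIso (S₁ := S) (S₂ := S) r h₀ h₁ (Iso.refl _) (Category.id_comp _)) := by
  refine ⟨Category.comp_id _, Category.comp_id _, S.top, S.top, Category.comp_id _,
    S.isPullback.w, Category.comp_id _, S.isPullback.w, ?_, ?_, rfl, ?_, rfl⟩ <;>
  exact (Category.id_comp _).trans (Category.comp_id _).symm

namespace InvGpd

section Cover

variable {X Y P : InvGpd.{u}}

section

variable (r : Y ⟶ P)

/-- The objects of `Y` together with two copies of those of `P`. -/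
def CoverPt (_ : Y ⟶ P) : Type u := Y.carrier ⊕ P.carrier × Bool

variable {r} in
def CoverPt.toBase : CoverPt r → P.carrier
  | Sum.inl y => r.functor.obj y
  | Sum.inr (x, _) => x

/-- Morphisms are taken from the base, so the projection is fully faithful and functors into the
cover are free to choose their objects. -/
instance : Groupoid (CoverPt r) where
  Hom a b := a.toBase ⟶ b.toBase
  id a := 𝟙 a.toBase
  comp {a b c} s t := CategoryStruct.comp (X := a.toBase) (Y := b.toBase) (Z := c.toBase) s t
  id_comp _ := Category.id_comp (obj := P.carrier) _
  comp_id _ := Category.comp_id (obj := P.carrier) _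
  assoc _ _ _ := Category.assoc (obj := P.carrier) _ _ _
  inv {a b} s := Groupoid.inv (X := a.toBase) (Y := b.toBase) s
  inv_comp _ := Groupoid.inv_comp (obj := P.carrier) _
  comp_inv _ := Groupoid.comp_inv (obj := P.carrier) _

def coverFunctor : CoverPt r ⥤ P.carrier where
  obj a := a.toBase
  map s := s
  map_id _ := rfl
  map_comp _ _ := rfl

variable {r} in
theorem coverFunctor_ext {D : Type*} [Category D] {F G : D ⥤ CoverPt r}
    (h : F ⋙ coverFunctor r = G ⋙ coverFunctor r) (hobj : ∀ d, F.obj d = G.obj d) : F = G :=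
  Functor.hext hobj fun _ _ k => Functor.hcongr_hom h k

variable {r} in
/-- A functor into the cover, from its values on objects and its composition with the projection
to the base. -/
def coverLift {D : Type*} [Category D] (F : D ⥤ P.carrier) (o : D → CoverPt r)
    (h : ∀ d, (o d).toBase = F.obj d) : D ⥤ CoverPt r where
  obj := o
  map {d d'} k := (eqToHom (h d) ≫ F.map k ≫ eqToHom (h d').symm : (o d).toBase ⟶ (o d').toBase)
  map_id d := by
    change eqToHom (h d) ≫ F.map (𝟙 d) ≫ eqToHom (h d).symm = 𝟙 (o d).toBase
    simp
  map_comp {d d' d''} k l := by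
    change eqToHom (h d) ≫ F.map (k ≫ l) ≫ eqToHom (h d'').symm =
      (eqToHom (h d) ≫ F.map k ≫ eqToHom (h d').symm) ≫
        eqToHom (h d') ≫ F.map l ≫ eqToHom (h d'').symm
    simp

variable {r} in
theorem coverLift_comp {D : Type*} [Category D] (F : D ⥤ P.carrier) (o : D → CoverPt r)
    (h : ∀ d, (o d).toBase = F.obj d) : coverLift F o h ⋙ coverFunctor r = F :=
  CategoryTheory.Functor.ext h fun _ _ _ => rfl

/-- The involution of the cover interchanges the two copies of `P`. -/
def coverInvObj : CoverPt r → CoverPt r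
  | Sum.inl y => Sum.inl (Y.inv.obj y)
  | Sum.inr (x, b) => Sum.inr (P.inv.obj x, !b)

theorem toBase_coverInvObj (a : CoverPt r) :
    (coverInvObj r a).toBase = (coverFunctor r ⋙ P.inv).obj a := by
  obtain y | ⟨x, b⟩ := a
  · exact obj_inv r y
  · rfl

theorem coverInvObj_coverInvObj (a : CoverPt r) : coverInvObj r (coverInvObj r a) = a := by
  obtain y | ⟨x, b⟩ := a
  · exact congrArg Sum.inl (inv_inv_obj y)
  · exact congrArg Sum.inr (Prod.ext (inv_inv_obj x) (Bool.not_not b))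

/-- A cover of `P` that has no fixed points besides those coming from `Y`. -/
def cover : InvGpd.{u} where
  carrier := CoverPt r
  inv := coverLift (coverFunctor r ⋙ P.inv) (coverInvObj r) (toBase_coverInvObj r)
  inv_inv := by
    refine coverFunctor_ext ?_ (coverInvObj_coverInvObj r)
    rw [Functor.assoc, coverLift_comp, ← Functor.assoc, coverLift_comp, Functor.assoc, P.inv_inv]
    rfl

def coverπ : cover r ⟶ P := ⟨coverFunctor r, coverLift_comp _ _ _⟩

def coverι : Y ⟶ cover r where
  functor := coverLift r.functor Sum.inl fun _ => rfl
  comm := by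
    refine coverFunctor_ext ?_ fun _ => rfl
    have h := r.comm
    rw [← coverLift_comp (r := r) r.functor Sum.inl fun _ => rfl] at h
    exact h.trans (congrArg (coverLift r.functor Sum.inl (fun _ => rfl) ⋙ ·)
      (coverπ r).comm.symm)

theorem coverι_coverπ : coverι r ≫ coverπ r = r := hom_ext (coverLift_comp _ _ _)

/-- Projective fibrations lift isomorphisms with no regard to the involution, so either copy of `P`
provides the lift. -/
theorem projFib_coverπ : projFib (coverπ r) := fun _ y g =>
  ⟨(Sum.inr (y, true) : CoverPt r), g, rfl, eq_comp_eqToHom _ _⟩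

end

/-- A projective acyclic cofibration is surjective on fixed objects. -/
theorem exists_of_llp_projFib {r : Y ⟶ P} (hr : projFib.llp r) {x : P.carrier}
    (hx : P.inv.obj x = x) : ∃ y, r.functor.obj y = x := by
  -- A lift is an equivariant section of the cover, so it sends `x` to a fixed point. The involution
  -- flips the labels, so that point comes from `Y`.
  have sq : CommSq (coverι r) r (coverπ r) (𝟙 P) :=
    ⟨by rw [coverι_coverπ, Category.comp_id]⟩
  have := hr _ (projFib_coverπ r)
  have hs := obj_inv sq.lift x
  rw [hx] at hs
  have hπ : (coverπ r).functor.obj (sq.lift.functor.obj x) = x :=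
    Functor.congr_obj (congrArg Hom.functor sq.fac_right) x
  generalize sq.lift.functor.obj x = s at hs hπ
  obtain y | ⟨z, b⟩ := s
  · exact ⟨y, hπ⟩
  · have h : (Sum.inr (z, b) : Y.carrier ⊕ P.carrier × Bool) = Sum.inr (P.inv.obj z, !b) := hs
    simp at h

/-- The homotopy takes a fixed object to a fixed path, which is in the image of the reflexivity map
and hence has equal ends. -/
theorem obj_eq_of_rightHomotopic {f g : X ⟶ Y} (h : RightHomotopic projFib f g) {x : X.carrier}
    (hx : X.inv.obj x = x) : f.functor.obj x = g.functor.obj x := by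
  obtain ⟨T, hT, P, r, d₀, d₁, H, hP, rfl, rfl⟩ := h
  obtain ⟨y, hy⟩ := exists_of_llp_projFib hP.acyclicCofibration (x := H.functor.obj x)
    (by rw [← obj_inv, hx])
  change d₀.functor.obj (H.functor.obj x) = d₁.functor.obj (H.functor.obj x)
  rw [← hy]
  exact (Functor.congr_obj (congrArg Hom.functor hP.r_d₀) y).trans
    (Functor.congr_obj (congrArg Hom.functor hP.r_d₁) y).symm

theorem exists_fixed_of_isRightHomotopyEquiv {f : X ⟶ Y} (h : IsRightHomotopyEquiv projFib f)
    {y : Y.carrier} (hy : Y.inv.obj y = y) : ∃ x, X.inv.obj x = x ∧ f.functor.obj x = y := by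
  obtain ⟨g, -, hg⟩ := h
  exact ⟨g.functor.obj y, by rw [← obj_inv, hy], obj_eq_of_rightHomotopic hg hy⟩

theorem one_hom_ext {f g : one ⟶ X}
    (h : f.functor.obj ⟨PUnit.unit⟩ = g.functor.obj ⟨PUnit.unit⟩) : f = g := by
  refine hom_ext (Functor.hext (fun _ => h) ?_)
  rintro ⟨⟨⟩⟩ ⟨⟨⟩⟩ k
  have hk : k = 𝟙 (Discrete.mk PUnit.unit) := Subsingleton.elim (α := Discrete.mk _ ⟶ _) _ _
  subst hk
  have h₁ : HEq (𝟙 (f.functor.obj ⟨PUnit.unit⟩)) (𝟙 (g.functor.obj ⟨PUnit.unit⟩)) := by rw [h]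
  exact (heq_of_eq (f.functor.map_id _)).trans (h₁.trans (heq_of_eq (g.functor.map_id _)).symm)

/-- A fixed object, as a map from the terminal object. -/
def pointHom (x : X.carrier) (hx : X.inv.obj x = x) : one ⟶ X where
  functor := (Functor.const _).obj x
  comm := CategoryTheory.Functor.ext (fun _ => hx.symm) fun _ _ _ => by simp

end Cover

theorem projFib_toOne (X : InvGpd.{u}) : projFib (toOne X) := fun x _ _ =>
  ⟨x, 𝟙 x, Subsingleton.elim (α := Discrete PUnit) _ _,
    Subsingleton.elim (α := Discrete.mk _ ⟶ _) _ _⟩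

section NotUnivalent

variable (κ : Cardinal.{w})

/-- A two-element set paired with itself. -/
def boolPt (hκ : Cardinal.aleph0 < κ) : UPt κ where
  A := ULift Bool
  B := ULift Bool
  hA := (Cardinal.lt_aleph0_of_finite _).trans hκ
  hB := (Cardinal.lt_aleph0_of_finite _).trans hκ
  φ := Equiv.refl _

def liftNot : ULift.{w} Bool ≃ ULift.{w} Bool :=
  Equiv.ulift.trans (Equiv.boolNot.trans Equiv.ulift.symm)

variable {κ} (hκ : Cardinal.aleph0 < κ)

def boolHom : one ⟶ U κ := pointHom (X := U κ) (boolPt κ hκ) rfl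

def boolNotHom : boolPt κ hκ ⟶ boolPt κ hκ :=
  (⟨liftNot, liftNot, fun _ => rfl⟩ : UHom (boolPt κ hκ) (boolPt κ hκ))

def boolIso : toUPt (boolHom hκ) ≅ toUPt (boolHom hκ) :=
  NatIso.ofComponents (fun _ => (Groupoid.isoEquivHom (C := UPt κ) _ _).symm (boolNotHom hκ))
    fun _ => (Category.id_comp (boolNotHom hκ)).trans (Category.comp_id _).symm

/-- Negation, as an automorphism of the pullback of `p` along `boolHom`. -/
def boolPbIso : (stdPullback (boolHom hκ)).X ≅ (stdPullback (boolHom hκ)).X :=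
  transportIso (boolIso hκ) (fun _ => eqToHom_comp_eq_comp_eqToHom (D := UPt κ) rfl _ _)
    fun _ => eqToHom_comp_eq_comp_eqToHom (D := UPt κ) rfl _ _

theorem boolPbIso_ne : (boolPbIso hκ).hom ≠ 𝟙 _ := fun h => by
  have h' := congrArg pbVPt (Functor.congr_obj (congrArg Hom.functor h)
    (pbMk (boolHom hκ) ⟨PUnit.unit⟩ (boolPt κ hκ) rfl (ULift.up true)))
  have h'' : ULift.up false = ULift.up true :=
    vPt_mk_injective (X := boolPt κ hκ) h'
  simp at h''

/-- Negation defines a map from the point to `E`, for whatever path object is chosen. Univalence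
would factor it through `U ⟶ E`, making negation the identity. -/
theorem not_isUnivalent_projFib (hκ : Cardinal.aleph0 < κ) : ¬ IsUnivalent projFib (p κ) := by
  rintro ⟨P, r, d₀, d₁, hP, 𝓔, h⟩
  obtain ⟨t, ht, -⟩ := 𝓔.existsUnique _ _ (EquivOver.ofIso r hP.r_d₀ hP.r_d₁ (boolPbIso hκ) rfl)
  obtain ⟨x, hx, hxt⟩ := exists_fixed_of_isRightHomotopyEquiv h
    (y := t.functor.obj ⟨PUnit.unit⟩) (obj_inv t ⟨PUnit.unit⟩).symm
  have hx' : pointHom x hx ≫ 𝓔.idMap r hP.r_d₀ hP.r_d₁ = t := one_hom_ext hxt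
  have hid := 𝓔.isRestriction_idMap r hP.r_d₀ hP.r_d₁
  -- Projecting to `U` shows that the fixed object found must be the two-element type itself.
  have hxa : pointHom x hx = boolHom hκ := by
    rw [← ht.1, ← hx', Category.assoc, hid.1, Category.comp_id]
  rw [hxa] at hx'
  have h' := hid.trans (EquivOver.isRestriction_refl hP.r_d₀ hP.r_d₁ (stdPullback (boolHom hκ)))
  rw [hx'] at h'
  exact boolPbIso_ne hκ (ht.f_eq h')

end NotUnivalent

end InvGpd
end TTFib

/-! ### The main theorem -/

theorem mainTheorem1 (κ : Cardinal.{w}) (hκ : κ.IsInaccessible) :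
    -- the injective structure, on the full subcategory of fibrant objects
    (∃ (h1 : injFibrant one.{w + 1}) (hU : injFibrant (U κ)) (hV : injFibrant (UTilde κ))
      (hPV : injFibrant (path (p κ))) (hPU : injFibrant (path (toOne (U κ)))),
      -- `p` is a fibration and is univalent
      fib (fibHom hV hU (p κ)) ∧
      IsUnivalent fib (fibHom hV hU (p κ)) ∧
      -- `δ₁ : U ⟶ P_1 U`
      injAcyclicCof (δ₁ (toOne (U κ))) ∧
      IsPathObject fib (fibHom hU h1 (toOne (U κ))) (fibHom hU hPU (δ₁ (toOne (U κ))))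
        (fibHom hPU hU (src (toOne (U κ)))) (fibHom hPU hU (tgt (toOne (U κ)))) ∧
      IsRightHomotopyEquiv fib (fibHom hU hPU (δ₁ (toOne (U κ)))) ∧
      -- the object `E` of equivalences over `U × U`, for the path object `P_U Ũ` of `p`, and the
      -- map `U ⟶ E`
      ∃ hP : IsPathObject fib (fibHom hV hU (p κ)) (fibHom hV hPV (δ₁ (p κ)))
          (fibHom hPV hV (src (p κ))) (fibHom hPV hV (tgt (p κ))),
        Nonempty (EquivObject (fibHom hV hU (p κ))
          (fibHom hPV hV (src (p κ))) (fibHom hPV hV (tgt (p κ)))) ∧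
        ∀ 𝓔 : EquivObject (fibHom hV hU (p κ))
            (fibHom hPV hV (src (p κ))) (fibHom hPV hV (tgt (p κ))),
          (∃ θ : 𝓔.E ≅ ⟨path (toOne (U κ)), hPU⟩,
            θ.hom ≫ fibHom hPU hU (src (toOne (U κ))) = 𝓔.e₀ ∧
            θ.hom ≫ fibHom hPU hU (tgt (toOne (U κ))) = 𝓔.e₁ ∧
            𝓔.idMap _ hP.r_d₀ hP.r_d₁ ≫ θ.hom = fibHom hU hPU (δ₁ (toOne (U κ)))) ∧
          fib.llp (𝓔.idMap _ hP.r_d₀ hP.r_d₁) ∧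
          IsRightHomotopyEquiv fib (𝓔.idMap _ hP.r_d₀ hP.r_d₁)) ∧
    -- the projective structure, in which all objects are fibrant: `p` is not univalent
    (∀ X : InvGpd.{w + 1}, projFib (toOne X)) ∧
    projFib (p κ) ∧
    IsPathObject projFib (p κ) (δ₁ (p κ)) (src (p κ)) (tgt (p κ)) ∧
    Nonempty (EquivObject (p κ) (src (p κ)) (tgt (p κ))) ∧
    ¬ IsUnivalent projFib (p κ) := by
  have h1 := injFibrant_one.{w + 1}
  have hU := injFibrant_U κ
  have hV := injFibrant_UTilde κ
  have hPV : injFibrant (path (p κ)) := injFibrant_path (injFib_p κ) hV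
  have hPU : injFibrant (path (toOne (U κ))) := injFibrant_path hU hU
  have hP := isPathObject_fib (fibHom hV hU (p κ)) (injFib_p κ) hPV
  have hδ := δ₁_injAcyclicCof (toOne (U κ))
  have hpd := p_isDiscreteFibration κ
  obtain ⟨𝓔, -⟩ := exists_fib_equivObject hU hV hPV hPU
  have := isIso_δ₁ (p κ) hpd
  exact ⟨⟨h1, hU, hV, hPV, hPU, injFib_p κ,
    ⟨_, _, _, _, hP, 𝓔, (fib_equivObject_spec hU hV hPV hPU 𝓔 hP.r_d₀ hP.r_d₁).2.2⟩, hδ,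
    isPathObject_fib (fibHom hU h1 (toOne (U κ))) hU hPU,
    isRightHomotopyEquiv_of_fib_llp (fib_llp hδ), hP, ⟨𝓔⟩,
    fun 𝓔 => fib_equivObject_spec hU hV hPV hPU 𝓔 hP.r_d₀ hP.r_d₁⟩,
    projFib_toOne, hpd.projFib, isPathObject_proj (p κ) hpd,
    ⟨EquivObject.ofIsGenericIso (δ₁_src (p κ)) (δ₁_tgt (p κ)) (genericIso_left κ)
      -- Of inaccessibility only `ℵ₀ < κ` is needed, to place a two-element set in `U`.
      (isGenericIso κ)⟩, not_isUnivalent_projFib hκ.aleph0_lt⟩
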